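/- A region is a nonempty open connected subset of $\mathbb{C}$, and $\mathbb{D}=\{z\in\mathbb{C}:|z|<1\}$. For a region $D$ whose complement $\mathbb{C}\setminus D$ contains at least two points, let $\lambda_D$ denote its hyperbolic density of curvature $-4$, that is, the function on $D$ determined by $\lambda_D(g(\zeta))\,|g'(\zeta)|=\dfrac{1}{1-|\zeta|^2}$ $(\zeta\in\mathbb{D})$ for an analytic universal covering map $g$ of $\mathbb{D}$ onto $D$ (it does not depend on the choice of $g$). For a region $G\neq\mathbb{C}$ and $w\in G$, let $\delta_G(w)$ be the Euclidean distance from $w$ to the boundary $\partial G$. A conformal mapping in $D$ is an analytic injective function $f:D\to\mathbb{C}$. **Theorem 2.1.** Let $D\subsetneq\mathbb{C}$ be a simply connected region and let $f$ be a conformal mapping in $D$. Then $f(D)$ has nonempty boundary and $$\lambda_D(z)\le\frac{|f'(z)|}{\delta_{f(D)}(f(z))}\le 4\,\lambda_D(z)\qquad\text{for all } z\in D.$$ Both inequalities are sharp, already for $D=\mathbb{D}$: the Koebe function $k(z)=z/(1-z)^2$ is a conformal mapping in $\mathbb{D}$ and $$\frac{|k'(x)|}{\delta_{k(\mathbb{D})}(k(x))}=4\,\lambda_{\mathbb{D}}(x)\qquad\text{for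 all real } x \text{ with } -1<x<1,$$ while for the identity function $f(z)=z$ in $\mathbb{D}$ $$\frac{|f'(0)|}{\delta_{\mathbb{D}}(f(0))}=1=\lambda_{\mathbb{D}}(0).$$ -/

import Mathlib

noncomputable section

/-- A conformal mapping in `D`: analytic and univalent (injective). -/
structure IsConformalOn (f : ℂ → ℂ) (D : Set ℂ) : Prop where
  differentiableOn : DifferentiableOn ℂ f D
  injOn : Set.InjOn f D

/-- `g` is an analytic covering map of the open unit disk onto `D`.  As the disk is simply
connected, it is then a universal covering map. -/
structure IsDiskCovering (g : ℂ → ℂ) (D : Set ℂ) : Prop where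
  differentiableOn : DifferentiableOn ℂ g (Metric.ball 0 1)
  surjOn : Set.SurjOn g (Metric.ball 0 1) D
  exists_isCoveringMap : ∃ h : Set.MapsTo g (Metric.ball 0 1) D, IsCoveringMap h.restrict

open Classical in
/-- The hyperbolic density `λ_D` with curvature `-4`, given by
`λ_D (g ζ) * |g' ζ| = 1 / (1 - |ζ|²)` for an analytic universal covering map `g` of the unit disk
onto `D`.  The value at `w` does not depend on the choice of `g` and of the point `ζ` over `w`;
it is `0` by convention if there is no such pair. -/
def hyperbolicDensity (D : Set ℂ) (w : ℂ) : ℝ :=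
  if h : ∃ p : (ℂ → ℂ) × ℂ, IsDiskCovering p.1 D ∧ p.2 ∈ Metric.ball (0 : ℂ) 1 ∧ p.1 p.2 = w then
    1 / ((1 - ‖h.choose.2‖ ^ 2) * ‖deriv h.choose.1 h.choose.2‖)
  else 0

/-- The Euclidean distance `δ_D z` from `z` to the boundary of `D`. -/
def boundaryDist (D : Set ℂ) (z : ℂ) : ℝ := Metric.infDist z (frontier D)

/-- The Koebe function. -/
def koebe (z : ℂ) : ℂ := z / (1 - z) ^ 2

end

/-! ### Univalent functions: open mapping and holomorphic inverse. -/

section UnivalentFunctions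

open Set Metric Filter Topology

namespace IsConformalOn

variable {f g : ℂ → ℂ} {D E : Set ℂ}

/-! A Riemann map g of the disk onto D and a disk automorphism reduce both inequalities to one
point: for F univalent in the disk, with δ the distance from F(0) to the boundary of the image, δ ≤
|F'(0)| ≤ 4δ. Indeed (1 - |ζ|²)|(f ∘ g)'(ζ)| is the modulus of the derivative at 0 of f ∘ g ∘
`diskAut ζ`, and the factor (1 - |ζ|²)|g'(ζ)| is the reciprocal of the density.

The left inequality is Schwarz–Pick for the inverse of F on the disk of radius δ about F(0). The
right one is the Koebe quarter theorem. If F omits 0, a square root G of F never takes opposite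
values, so H = (G - c)/(G + c) with c = G(0) satisfies H(z)H(w) ≠ 1 and H(0) = 0. It suffices that
|H'(0)| ≤ 1. This comes from the area element dA/|w|²: H and 1/H map a thin-holed annulus to
disjoint sets, each of logarithmic area at least that of the annulus, and both lie in one annulus ρ
≤ |w| ≤ 1/ρ (`radius_le_of_ball_subset_image`).

The density is defined by an arbitrary covering, so two more facts are needed: a covering of a
simply connected region is injective, and one exists, by the Riemann mapping theorem. -/

theorem mono (hf : IsConformalOn f D) (h : E ⊆ D) : IsConformalOn f E :=
  ⟨hf.differentiableOn.mono h, hf.injOn.mono h⟩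

theorem comp (hg : IsConformalOn g E) (hf : IsConformalOn f D) (h : MapsTo f D E) :
    IsConformalOn (g ∘ f) D :=
  ⟨hg.differentiableOn.comp hf.differentiableOn h, hg.injOn.comp hf.injOn h⟩

theorem differentiableAt (hf : IsConformalOn f D) (hD : IsOpen D) {z : ℂ} (hz : z ∈ D) :
    DifferentiableAt ℂ f z :=
  hf.differentiableOn.differentiableAt (hD.mem_nhds hz)

theorem analyticAt (hf : IsConformalOn f D) (hD : IsOpen D) {z : ℂ} (hz : z ∈ D) :
    AnalyticAt ℂ f z :=
  hf.differentiableOn.analyticAt (hD.mem_nhds hz)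

theorem not_eventually_eq (hf : IsConformalOn f D) (hD : IsOpen D) {z : ℂ} (hz : z ∈ D) :
    ¬ ∀ᶠ w in 𝓝 z, f w = f z := by
  intro h
  obtain ⟨w, ⟨hw, hwD⟩, hne⟩ :=
    ((h.and (hD.mem_nhds hz)).filter_mono nhdsWithin_le_nhds |>.and
      (self_mem_nhdsWithin : {z}ᶜ ∈ 𝓝[≠] z)).exists
  exact hne (hf.injOn hwD hz hw)

/-- Injectivity excludes the locally constant alternative of the open mapping theorem. Openness of
images and continuity of the inverse both rest on this. -/
theorem nhds_le_map (hf : IsConformalOn f D) (hD : IsOpen D) {z : ℂ} (hz : z ∈ D) :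
    𝓝 (f z) ≤ map f (𝓝 z) :=
  (hf.analyticAt hD hz).eventually_constant_or_nhds_le_map_nhds.resolve_left
    (hf.not_eventually_eq hD hz)

theorem isOpen_image (hf : IsConformalOn f D) (hD : IsOpen D) : IsOpen (f '' D) := by
  rw [isOpen_iff_mem_nhds]
  rintro _ ⟨z, hz, rfl⟩
  exact hf.nhds_le_map hD hz (image_mem_map (hD.mem_nhds hz))

theorem continuousAt_of_leftInvOn (hf : IsConformalOn f D) (hD : IsOpen D)
    (h : LeftInvOn g f D) {z : ℂ} (hz : z ∈ D) : ContinuousAt g (f z) := by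
  rw [ContinuousAt, h hz]
  refine (tendsto_map'_iff.2 ?_).mono_left (hf.nhds_le_map hD hz)
  refine tendsto_id.congr' ?_
  filter_upwards [hD.mem_nhds hz] with w hw using (h hw).symm

theorem eventually_deriv_ne_zero (hf : IsConformalOn f D) (hD : IsOpen D) {z : ℂ} (hz : z ∈ D) :
    ∀ᶠ w in 𝓝[≠] z, deriv f w ≠ 0 := by
  refine (hf.analyticAt hD hz).deriv.eventually_eq_zero_or_eventually_ne_zero.resolve_left
    fun h ↦ hf.not_eventually_eq hD hz ?_
  obtain ⟨ε, hε, hball⟩ := Metric.eventually_nhds_iff_ball.1 (h.and (hD.mem_nhds hz))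
  filter_upwards [ball_mem_nhds z hε] with w hw
  refine isOpen_ball.is_const_of_deriv_eq_zero (convex_ball z ε).isPreconnected
    (hf.differentiableOn.mono fun x hx ↦ (hball x hx).2) (fun x hx ↦ (hball x hx).1) hw
    (mem_ball_self hε)

/-- The inverse of a univalent function is holomorphic. -/
theorem differentiableAt_of_leftInvOn (hf : IsConformalOn f D) (hD : IsOpen D)
    (h : LeftInvOn g f D) {z : ℂ} (hz : z ∈ D) : DifferentiableAt ℂ g (f z) := by
  -- Zeros of f' are isolated, so the inverse is differentiable on a punctured neighbourhood, and
  -- continuity removes the singularity. That f' has no zeros at all is only a consequence, by the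
  -- chain rule.
  refine (Complex.analyticAt_of_differentiable_on_punctured_nhds_of_continuousAt ?_
    (hf.continuousAt_of_leftInvOn hD h hz)).differentiableAt
  have h1 : ∀ᶠ w in 𝓝 z, w ≠ z → deriv f w ≠ 0 ∧ w ∈ D :=
    (eventually_nhdsWithin_iff.1 (hf.eventually_deriv_ne_zero hD hz)).and (hD.mem_nhds hz) |>.mono
      fun w hw hne ↦ ⟨hw.1 hne, hw.2⟩
  rw [eventually_nhdsWithin_iff]
  have hmap : f '' {w | (w ≠ z → deriv f w ≠ 0 ∧ w ∈ D)} ∈ 𝓝 (f z) :=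
    hf.nhds_le_map hD hz (image_mem_map h1)
  filter_upwards [hmap]
  rintro _ ⟨w, hw, rfl⟩ hne
  obtain ⟨hw0, hwD⟩ := hw fun e ↦ hne (by rw [e]; rfl)
  refine (HasDerivAt.of_local_left_inverse (f := f) (hf.continuousAt_of_leftInvOn hD h hwD) ?_ hw0
    ?_).differentiableAt
  · rw [h hwD]; exact (hf.differentiableAt hD hwD).hasDerivAt
  · filter_upwards [(hf.isOpen_image hD).mem_nhds (mem_image_of_mem f hwD)]
    rintro _ ⟨x, hx, rfl⟩
    rw [h hx]

theorem deriv_mul_deriv_of_leftInvOn (hf : IsConformalOn f D) (hD : IsOpen D)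
    (h : LeftInvOn g f D) {z : ℂ} (hz : z ∈ D) : deriv g (f z) * deriv f z = 1 := by
  have h1 := (hf.differentiableAt_of_leftInvOn hD h hz).hasDerivAt.comp z
    (hf.differentiableAt hD hz).hasDerivAt
  refine h1.unique ((hasDerivAt_id z).congr_of_eventuallyEq ?_)
  filter_upwards [hD.mem_nhds hz] with w hw using h hw

theorem deriv_ne_zero (hf : IsConformalOn f D) (hD : IsOpen D) {z : ℂ} (hz : z ∈ D) :
    deriv f z ≠ 0 :=
  right_ne_zero_of_mul_eq_one
    (hf.deriv_mul_deriv_of_leftInvOn hD hf.injOn.leftInvOn_invFunOn hz)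

theorem of_leftInvOn (hf : IsConformalOn f D) (hD : IsOpen D) (h : LeftInvOn g f D) :
    IsConformalOn g (f '' D) := by
  refine ⟨?_, ?_⟩
  · rintro _ ⟨z, hz, rfl⟩
    exact (hf.differentiableAt_of_leftInvOn hD h hz).differentiableWithinAt
  · rintro _ ⟨z, hz, rfl⟩ _ ⟨w, hw, rfl⟩ hzw
    rw [← h hz, hzw, h hw]

end IsConformalOn

end UnivalentFunctions

/-! ### Disk automorphisms and the Schwarz–Pick lemma. -/

section DiskAutomorphisms

open Set Metric ComplexConjugate

/-- The automorphism of the unit disk that sends `0` to `a`. -/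
noncomputable def diskAut (a z : ℂ) : ℂ := (z + a) / (1 + conj a * z)

variable {a z : ℂ}

theorem one_add_conj_mul_ne_zero (ha : a ∈ ball (0 : ℂ) 1) (hz : z ∈ ball (0 : ℂ) 1) :
    1 + conj a * z ≠ 0 := by
  rw [mem_ball_zero_iff] at ha hz
  intro h
  have h1 : ‖conj a * z‖ = 1 := by
    rw [← norm_neg, ← eq_neg_of_add_eq_zero_left h, norm_one]
  rw [norm_mul, RCLike.norm_conj] at h1
  nlinarith [norm_nonneg a, norm_nonneg z]

theorem diskAut_mem_ball (ha : a ∈ ball (0 : ℂ) 1) (hz : z ∈ ball (0 : ℂ) 1) :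
    diskAut a z ∈ ball (0 : ℂ) 1 := by
  have h0 := one_add_conj_mul_ne_zero ha hz
  rw [mem_ball_zero_iff] at ha hz ⊢
  rw [diskAut, norm_div, div_lt_one (norm_pos_iff.2 h0), ← sq_lt_sq₀ (norm_nonneg _) (norm_nonneg _)]
  have ha2 : ‖a‖ ^ 2 < 1 := by nlinarith [norm_nonneg a]
  have hz2 : ‖z‖ ^ 2 < 1 := by nlinarith [norm_nonneg z]
  rw [← Complex.normSq_eq_norm_sq] at *
  rw [← Complex.normSq_eq_norm_sq] at *
  simp only [Complex.normSq_apply, Complex.add_re, Complex.add_im, Complex.mul_re, Complex.mul_im,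
    Complex.conj_re, Complex.conj_im, Complex.one_re, Complex.one_im] at *
  -- The identity used is |1 + āz|² - |z + a|² = (1 - |a|²)(1 - |z|²).
  nlinarith [mul_pos (sub_pos.2 ha2) (sub_pos.2 hz2)]

theorem neg_mem_unitBall (ha : a ∈ ball (0 : ℂ) 1) : -a ∈ ball (0 : ℂ) 1 := by
  simpa using ha

theorem diskAut_neg_diskAut (ha : a ∈ ball (0 : ℂ) 1) (hz : z ∈ ball (0 : ℂ) 1) :
    diskAut (-a) (diskAut a z) = z := by
  have h0 := one_add_conj_mul_ne_zero ha hz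
  have h1 := one_add_conj_mul_ne_zero (neg_mem_unitBall ha) (diskAut_mem_ball ha hz)
  have h2 : (1 + conj a * z) * diskAut a z = z + a := mul_div_cancel₀ _ h0
  rw [diskAut, div_eq_iff h1, ← mul_right_inj' h0, map_neg]
  linear_combination (1 + conj a * z) * h2

theorem diskAut_diskAut_neg (ha : a ∈ ball (0 : ℂ) 1) (hz : z ∈ ball (0 : ℂ) 1) :
    diskAut a (diskAut (-a) z) = z := by
  simpa using diskAut_neg_diskAut (neg_mem_unitBall ha) hz

theorem differentiableOn_diskAut (ha : a ∈ ball (0 : ℂ) 1) :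
    DifferentiableOn ℂ (diskAut a) (ball 0 1) := by
  refine DifferentiableOn.div (by fun_prop) (by fun_prop) fun _ hz ↦ one_add_conj_mul_ne_zero ha hz

theorem isConformalOn_diskAut (ha : a ∈ ball (0 : ℂ) 1) :
    IsConformalOn (diskAut a) (ball 0 1) :=
  ⟨differentiableOn_diskAut ha,
    fun z hz w hw h ↦ by rw [← diskAut_neg_diskAut ha hz, h, diskAut_neg_diskAut ha hw]⟩

theorem mapsTo_diskAut (ha : a ∈ ball (0 : ℂ) 1) :
    MapsTo (diskAut a) (ball 0 1) (ball 0 1) := fun _ hz ↦ diskAut_mem_ball ha hz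

theorem image_diskAut (ha : a ∈ ball (0 : ℂ) 1) : diskAut a '' ball 0 1 = ball 0 1 :=
  (mapsTo_diskAut ha).image_subset.antisymm fun _ hz ↦
    ⟨_, diskAut_mem_ball (neg_mem_unitBall ha) hz, diskAut_diskAut_neg ha hz⟩

@[simp] theorem diskAut_zero : diskAut a 0 = a := by simp [diskAut]

@[simp] theorem diskAut_neg_self : diskAut (-a) a = 0 := by simp [diskAut]

theorem hasDerivAt_diskAut_zero (a : ℂ) : HasDerivAt (diskAut a) (1 - ‖a‖ ^ 2 : ℝ) 0 := by
  have h1 : HasDerivAt (fun z ↦ z + a) 1 0 := (hasDerivAt_id 0).add_const a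
  have h2 : HasDerivAt (fun z ↦ 1 + conj a * z) (conj a) 0 := by
    simpa using ((hasDerivAt_id (0 : ℂ)).const_mul (conj a)).const_add 1
  refine (h1.div h2 (by simp)).congr_deriv ?_
  simp [Complex.mul_conj, Complex.normSq_eq_norm_sq]

theorem deriv_diskAut_neg_self (ha : a ∈ ball (0 : ℂ) 1) :
    deriv (diskAut (-a)) a = ((1 - ‖a‖ ^ 2)⁻¹ : ℝ) := by
  have h := (isConformalOn_diskAut ha).deriv_mul_deriv_of_leftInvOn isOpen_ball
    (fun z hz ↦ diskAut_neg_diskAut ha hz) (mem_ball_self one_pos)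
  rw [diskAut_zero, (hasDerivAt_diskAut_zero a).deriv] at h
  rw [eq_inv_of_mul_eq_one_left h, Complex.ofReal_inv]

theorem one_sub_norm_sq_pos (ha : a ∈ ball (0 : ℂ) 1) : 0 < 1 - ‖a‖ ^ 2 := by
  rw [mem_ball_zero_iff] at ha
  nlinarith [norm_nonneg a]

/-- The **Schwarz–Pick lemma** at the centre of a disk. -/
theorem norm_deriv_mul_le_of_mapsTo_ball {f : ℂ → ℂ} {c : ℂ} {r : ℝ} (hr : 0 < r)
    (hf : DifferentiableOn ℂ f (ball c r)) (hm : MapsTo f (ball c r) (ball 0 1)) :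
    ‖deriv f c‖ * r ≤ 1 - ‖f c‖ ^ 2 := by
  have hc := mem_ball_self (x := c) hr
  have hfc := hm hc
  have hneg := neg_mem_unitBall hfc
  have hd : DifferentiableAt ℂ f c := hf.differentiableAt (isOpen_ball.mem_nhds hc)
  have hd' : DifferentiableAt ℂ (diskAut (-f c)) (f c) :=
    (differentiableOn_diskAut hneg).differentiableAt (isOpen_ball.mem_nhds hfc)
  have key := Complex.norm_deriv_le_div_of_mapsTo_ball (f := diskAut (-f c) ∘ f) (R₂ := 1)
    ((differentiableOn_diskAut hneg).comp hf hm)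
    (fun z hz ↦ by
      simpa using (mem_ball_zero_iff.1 (diskAut_mem_ball hneg (hm hz))).le) hr
  rw [deriv_comp c hd' hd, norm_mul, deriv_diskAut_neg_self hfc, Complex.norm_real,
    Real.norm_of_nonneg (inv_nonneg.2 (one_sub_norm_sq_pos hfc).le), le_div_iff₀ hr,
    mul_assoc, inv_mul_le_iff₀ (one_sub_norm_sq_pos hfc), mul_one] at key
  exact key

/-- The **Schwarz–Pick lemma** for self-maps of the unit disk. -/
theorem norm_deriv_mul_le_of_mapsTo_unitBall {f : ℂ → ℂ}
    (hf : DifferentiableOn ℂ f (ball 0 1)) (hm : MapsTo f (ball 0 1) (ball 0 1))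
    (hz : z ∈ ball (0 : ℂ) 1) : ‖deriv f z‖ * (1 - ‖z‖ ^ 2) ≤ 1 - ‖f z‖ ^ 2 := by
  have key := norm_deriv_mul_le_of_mapsTo_ball one_pos
    (hf.comp (differentiableOn_diskAut hz) (mapsTo_diskAut hz)) (hm.comp (mapsTo_diskAut hz))
  have h0 := hasDerivAt_diskAut_zero z
  have hd : DifferentiableAt ℂ f (diskAut z 0) := by
    rw [diskAut_zero]; exact hf.differentiableAt (isOpen_ball.mem_nhds hz)
  rw [deriv_comp 0 hd h0.differentiableAt, h0.deriv, norm_mul, Complex.norm_real,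
    Real.norm_of_nonneg (one_sub_norm_sq_pos hz).le, mul_one] at key
  simpa using key

end DiskAutomorphisms

/-! ### Montel, Hurwitz and the Riemann mapping theorem. -/

section RiemannMapping

open Set Metric Filter Topology

variable {ι : Type*} {U : Set ℂ} {F : ι → ℂ → ℂ} {f : ℂ → ℂ}

/-- **Montel's theorem** along an ultrafilter. -/
theorem exists_tendstoLocallyUniformlyOn_of_mapsTo_closedBall (𝒰 : Ultrafilter ι) (hU : IsOpen U)
    (hF : ∀ n, DifferentiableOn ℂ (F n) U) (hm : ∀ n, MapsTo (F n) U (closedBall 0 1)) :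
    ∃ f, TendstoLocallyUniformlyOn F f 𝒰 U := by
  have hlim : ∀ z, ∃ w, z ∈ U → Tendsto (F · z) 𝒰 (𝓝 w) := by
    intro z
    by_cases hz : z ∈ U
    · obtain ⟨w, -, hw⟩ := (isCompact_closedBall (0 : ℂ) 1).ultrafilter_le_nhds (𝒰.map (F · z))
        (le_principal_iff.2 (Filter.mem_map.2 (univ_mem' fun n ↦ hm n hz)))
      exact ⟨w, fun _ ↦ hw⟩
    · exact ⟨0, fun h ↦ absurd h hz⟩
  choose f hf using hlim
  refine ⟨f, Metric.tendstoLocallyUniformlyOn_iff.2 fun ε hε z hz ↦ ?_⟩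
  obtain ⟨R, hR, hRU⟩ := Metric.isOpen_iff.1 hU z hz
  -- Values lie within 2 of each other, so Schwarz's lemma gives one Lipschitz constant for all n.
  -- This upgrades the pointwise limit, which exists by compactness, to a locally uniform one.
  have hlip : ∀ n, ∀ w ∈ ball z R, dist (F n w) (F n z) ≤ 2 / R * dist w z := by
    intro n w hw
    refine Complex.dist_le_div_mul_dist_of_mapsTo_ball ((hF n).mono hRU) (fun x hx ↦ ?_) hw
    have h1 := hm n (hRU hx)
    have h2 := hm n hz
    rw [mem_closedBall_zero_iff] at h1 h2
    rw [mem_closedBall]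
    calc dist (F n x) (F n z) ≤ ‖F n x‖ + ‖F n z‖ := dist_le_norm_add_norm _ _
      _ ≤ 2 := by linarith
  have hlip' : ∀ w ∈ ball z R, dist (f w) (f z) ≤ 2 / R * dist w z := fun w hw ↦
    le_of_tendsto ((hf w (hRU hw)).dist (hf z hz)) (Eventually.of_forall fun n ↦ hlip n w hw)
  have hδ : 0 < min R (R * ε / 8) := by positivity
  refine ⟨ball z (min R (R * ε / 8)), mem_nhdsWithin_of_mem_nhds (ball_mem_nhds z hδ), ?_⟩
  filter_upwards [(Metric.tendsto_nhds.1 (hf z hz)) (ε / 4) (by positivity)] with n hn w hw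
  have hwR : w ∈ ball z R := ball_subset_ball (min_le_left _ _) hw
  have hsmall : 2 / R * dist w z ≤ ε / 4 := by
    have : dist w z ≤ R * ε / 8 := (mem_ball.1 hw).le.trans (min_le_right _ _)
    calc 2 / R * dist w z ≤ 2 / R * (R * ε / 8) := by gcongr
      _ = ε / 4 := by field_simp; norm_num
  have h1 := hlip n w hwR
  have h2 := hlip' w hwR
  have h3 := dist_triangle4 (f w) (f z) (F n z) (F n w)
  rw [dist_comm (f z) (F n z), dist_comm (F n z) (F n w)] at h3
  linarith

variable {φ : Filter ι}

/-- A local form of **Hurwitz's theorem**. -/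
theorem eventually_mem_image_of_tendstoLocallyUniformlyOn
    (hlim : TendstoLocallyUniformlyOn F f φ U) (hF : ∀ n, DifferentiableOn ℂ (F n) U)
    (hfd : DifferentiableOn ℂ f U) (hU : IsOpen U) {a : ℂ} (ha : a ∈ U)
    (hne : ¬ ∀ᶠ z in 𝓝 a, f z = f a) {δ : ℝ} (hδ : 0 < δ) :
    ∀ᶠ n in φ, f a ∈ F n '' (closedBall a δ ∩ U) := by
  have hev : ∀ᶠ z in 𝓝[≠] a, f z - f a ≠ 0 :=
    ((hfd.analyticAt (hU.mem_nhds ha)).sub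
      analyticAt_const).eventually_eq_zero_or_eventually_ne_zero.resolve_left
        fun h ↦ hne (h.mono fun z hz ↦ sub_eq_zero.1 hz)
  rw [eventually_nhdsWithin_iff] at hev
  obtain ⟨R, hR, hball⟩ := Metric.eventually_nhds_iff_ball.1 (hev.and (hU.mem_nhds ha))
  obtain ⟨r, hr0, hr⟩ := exists_between (lt_min hR hδ)
  have hrU : closedBall a r ⊆ U := fun z hz ↦
    (hball z (closedBall_subset_ball (hr.trans_le (min_le_left _ _)) hz)).2
  have hcont : ContinuousOn (fun z ↦ ‖f z - f a‖) (sphere a r) :=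
    ((hfd.continuousOn.mono (sphere_subset_closedBall.trans hrU)).sub continuousOn_const).norm
  obtain ⟨x, hx, hmin⟩ := (isCompact_sphere a r).exists_isMinOn
    (NormedSpace.sphere_nonempty.2 hr0.le) hcont
  have hε : 0 < ‖f x - f a‖ := norm_pos_iff.2 <|
    (hball x (closedBall_subset_ball (hr.trans_le (min_le_left _ _))
      (sphere_subset_closedBall hx))).1 (ne_of_mem_sphere hx hr0.ne')
  set ε := ‖f x - f a‖
  have hunif := (tendstoLocallyUniformlyOn_iff_forall_isCompact hU).1 hlim _ hrU
    (isCompact_closedBall a r)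
  filter_upwards [Metric.tendstoUniformlyOn_iff.1 hunif (ε / 8) (by positivity)] with n hn
  have hna := hn a (mem_closedBall_self hr0.le)
  -- Two errors of ε/8 leave 3ε/4 on the circle. The image of the closed disk then contains the disk
  -- of radius 3ε/8 about F n a, and f a is within ε/8 of that centre.
  have hsph : ∀ z ∈ sphere a r, 3 * ε / 4 ≤ ‖F n z - F n a‖ := by
    intro z hz
    have h1 : ε ≤ dist (f z) (f a) := by rw [dist_eq_norm]; exact hmin hz
    have h2 := hn z (sphere_subset_closedBall hz)
    have h3 := dist_triangle4 (f z) (F n z) (F n a) (f a)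
    rw [dist_comm (F n a) (f a)] at h3
    rw [← dist_eq_norm]
    linarith
  have hfreq : ∃ᶠ z in 𝓝 a, F n z ≠ F n a := by
    intro hcon
    have hcon : ∀ᶠ z in 𝓝 a, F n z = F n a := hcon.mono fun z hz ↦ not_not.1 hz
    have heq : EqOn (F n) (fun _ ↦ F n a) (closedBall a r) := by
      rw [← closure_ball a hr0.ne']
      refine EqOn.of_subset_closure (s := ball a r) ?_ ?_ continuousOn_const
        subset_closure Subset.rfl
      · exact (((hF n).mono (ball_subset_closedBall.trans hrU)).analyticOnNhd
          isOpen_ball).eqOn_of_preconnected_of_eventuallyEq analyticOnNhd_const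
          (convex_ball a r).isPreconnected (mem_ball_self hr0) hcon
      · rw [closure_ball a hr0.ne']; exact (hF n).continuousOn.mono hrU
    have := hsph x hx
    rw [heq (sphere_subset_closedBall hx), sub_self, norm_zero] at this
    linarith
  have himg := DiffContOnCl.ball_subset_image_closedBall (f := F n)
    (((hF n).mono hrU).diffContOnCl_ball Subset.rfl) hr0 hsph hfreq
  exact image_mono (subset_inter (closedBall_subset_closedBall (hr.le.trans (min_le_right _ _)))
    hrU)
    (himg (by rw [mem_ball]; linarith))

/-- **Hurwitz's theorem** for univalent functions. -/
theorem IsConformalOn.of_tendstoLocallyUniformlyOn [φ.NeBot]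
    (hlim : TendstoLocallyUniformlyOn F f φ U) (hF : ∀ n, IsConformalOn (F n) U)
    (hU : IsOpen U) (hUc : IsPreconnected U) {z₀ : ℂ} (hz₀ : z₀ ∈ U) (hd : deriv f z₀ ≠ 0) :
    IsConformalOn f U := by
  have hfd := hlim.differentiableOn (Eventually.of_forall fun n ↦ (hF n).differentiableOn) hU
  refine ⟨hfd, fun a ha b hb hab ↦ ?_⟩
  by_contra hne
  have hnc : ∀ c ∈ U, ¬ ∀ᶠ z in 𝓝 c, f z = f c := by
    intro c hc h
    have heq := (hfd.analyticOnNhd hU).eqOn_of_preconnected_of_eventuallyEq analyticOnNhd_const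
      hUc hc h
    refine hd ?_
    rw [EventuallyEq.deriv_eq (f := fun _ ↦ f c), deriv_const]
    filter_upwards [hU.mem_nhds hz₀] with z hz using heq hz
  -- Disks of this radius about a and b are disjoint, yet for some n the value f a = f b is taken by
  -- F n in both.
  have hδ : 0 < dist a b / 3 := by have := dist_pos.2 hne; positivity
  obtain ⟨n, ⟨x, ⟨hx, hxU⟩, hxa⟩, ⟨y, ⟨hy, hyU⟩, hyb⟩⟩ :=
    ((eventually_mem_image_of_tendstoLocallyUniformlyOn hlim (fun n ↦ (hF n).differentiableOn)
      hfd hU ha (hnc a ha) hδ).and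
    (eventually_mem_image_of_tendstoLocallyUniformlyOn hlim (fun n ↦ (hF n).differentiableOn)
      hfd hU hb (hnc b hb) hδ)).exists
  obtain rfl : x = y := (hF n).injOn hxU hyU (by rw [hxa, hyb, hab])
  have h1 := dist_triangle_left a b x
  rw [mem_closedBall] at hx hy
  linarith

/-- A holomorphic branch of the square root. -/
theorem exists_differentiableOn_sq_eq {h : ℂ → ℂ} (hU : IsOpen U) (hUc : IsSimplyConnected U)
    (hd : DifferentiableOn ℂ h U) (h0 : ∀ z ∈ U, h z ≠ 0) :
    ∃ s : ℂ → ℂ, DifferentiableOn ℂ s U ∧ ∀ z ∈ U, s z ^ 2 = h z := by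
  obtain ⟨s, hsc, hs⟩ := Complex.exists_continuousOn_pow_eq hUc hU hd.continuousOn
    (by rintro ⟨z, hz, hz0⟩; exact h0 z hz hz0) two_ne_zero
  refine ⟨s, fun z hz ↦ DifferentiableAt.differentiableWithinAt ?_, fun z _ ↦ hs z⟩
  have hsz : s z ≠ 0 := fun e ↦ h0 z hz (by rw [← hs z, e]; ring)
  have hcont : Tendsto (fun w ↦ s w + s z) (𝓝 z) (𝓝 (s z + s z)) :=
    (hsc.continuousAt (hU.mem_nhds hz)).tendsto.add_const _
  have hsum : s z + s z ≠ 0 := by rw [← two_mul]; exact mul_ne_zero two_ne_zero hsz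
  have hh := hasDerivAt_iff_tendsto_slope.1
    (hd.differentiableAt (hU.mem_nhds hz)).hasDerivAt
  -- The slope of s is the slope of h divided by s w + s z, whose limit 2 s z is nonzero.
  refine (hasDerivAt_iff_tendsto_slope.2
    ((hh.div (hcont.mono_left nhdsWithin_le_nhds) hsum).congr' ?_)).differentiableAt
  filter_upwards [nhdsWithin_le_nhds (hcont.eventually_ne hsum)] with w hw
  rw [Pi.div_apply, slope_def_field, slope_def_field, ← hs w, ← hs z, div_right_comm,
    sq_sub_sq, mul_div_cancel_left₀ _ hw]

theorem IsConformalOn.of_sq {s h : ℂ → ℂ} (hh : InjOn h U) (hs : DifferentiableOn ℂ s U)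
    (hsq : ∀ z ∈ U, s z ^ 2 = h z) : IsConformalOn s U :=
  ⟨hs, fun z hz w hw e ↦ hh hz hw (by rw [← hsq z hz, ← hsq w hw, e])⟩

/-- A branch s of √(z - a), with a outside U, never takes both v and -v. Its image contains a disk
about s b, hence omits the opposite disk about -s b, and an inversion centred there is bounded. -/
theorem exists_isConformalOn_mapsTo_unitBall (hU : IsOpen U) (hUc : IsSimplyConnected U)
    (hne : U ≠ univ) : ∃ f, IsConformalOn f U ∧ MapsTo f U (ball 0 1) := by
  obtain ⟨a, ha⟩ := (ne_univ_iff_exists_notMem U).1 hne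
  have h0 : ∀ z ∈ U, z - a ≠ 0 := fun z hz e ↦ ha (sub_eq_zero.1 e ▸ hz)
  obtain ⟨s, hsd, hs⟩ := exists_differentiableOn_sq_eq hU hUc
    (differentiableOn_id.sub_const a) h0
  have hsc : IsConformalOn s U := .of_sq (fun z _ w _ e ↦ sub_left_injective e) hsd hs
  obtain ⟨b, hb⟩ := hUc.nonempty
  obtain ⟨ε, hε, hball⟩ := Metric.isOpen_iff.1 (hsc.isOpen_image hU) _ (mem_image_of_mem s hb)
  have hfar : ∀ z ∈ U, ε ≤ ‖s z + s b‖ := by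
    intro z hz
    by_contra! hlt
    obtain ⟨w, hw, hwz⟩ := hball (show -s z ∈ ball (s b) ε by
      rwa [mem_ball, dist_eq_norm, ← norm_neg, show -(-s z - s b) = s z + s b by ring])
    have hzw : w = z := sub_left_injective (b := a) (by
      change w - a = z - a
      rw [← id_eq w, ← id_eq z, ← hs z hz, ← hs w hw, hwz, neg_sq])
    rw [hzw] at hwz
    have : s z = 0 := by linear_combination hwz / 2
    exact h0 z hz (by rw [← id_eq z, ← hs z hz, this]; ring)
  have hne0 : ∀ z ∈ U, s z + s b ≠ 0 := fun z hz e ↦ by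
    have := hfar z hz
    rw [e, norm_zero] at this
    linarith
  refine ⟨fun z ↦ (ε / 2 : ℝ) / (s z + s b), ⟨(differentiableOn_const _).div (hsd.add_const _)
    hne0, fun z hz w hw e ↦ ?_⟩, fun z hz ↦ ?_⟩
  · have hε' : ((ε / 2 : ℝ) : ℂ) ≠ 0 := Complex.ofReal_ne_zero.2 (by positivity)
    have e' := (div_eq_div_iff (hne0 z hz) (hne0 w hw)).1 e
    exact hsc.injOn hz hw (add_right_cancel (mul_left_cancel₀ hε' e').symm)
  · rw [mem_ball_zero_iff, norm_div, Complex.norm_real, Real.norm_of_nonneg (by positivity),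
      div_lt_one (norm_pos_iff.2 (hne0 z hz))]
    linarith [hfar z hz]

theorem mapsTo_unitBall_of_mapsTo_closedBall (hf : IsConformalOn f U) (hU : IsOpen U)
    (hm : MapsTo f U (closedBall 0 1)) : MapsTo f U (ball 0 1) := by
  have h := interior_maximal hm.image_subset (hf.isOpen_image hU)
  rw [interior_closedBall _ one_ne_zero] at h
  exact mapsTo_iff_image_subset.2 h

/-- The extremal problem of the Riemann mapping theorem has a solution. -/
theorem exists_isConformalOn_forall_norm_deriv_le (hU : IsOpen U) (hUc : IsSimplyConnected U)
    (hne : U ≠ univ) {z₀ : ℂ} (hz₀ : z₀ ∈ U) :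
    ∃ f, IsConformalOn f U ∧ MapsTo f U (ball 0 1) ∧
      ∀ g, IsConformalOn g U → MapsTo g U (ball 0 1) → ‖deriv g z₀‖ ≤ ‖deriv f z₀‖ := by
  obtain ⟨R, hR, hRU⟩ := Metric.isOpen_iff.1 hU z₀ hz₀
  obtain ⟨f₀, hf₀, hm₀⟩ := exists_isConformalOn_mapsTo_unitBall hU hUc hne
  set S : Set ℝ := {x | ∃ f, (IsConformalOn f U ∧ MapsTo f U (ball 0 1)) ∧ ‖deriv f z₀‖ = x}
  have hSne : S.Nonempty := ⟨_, f₀, ⟨hf₀, hm₀⟩, rfl⟩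
  have hSb : BddAbove S := by
    refine ⟨1 / R, ?_⟩
    rintro _ ⟨f, ⟨hf, hm⟩, rfl⟩
    rw [le_div_iff₀ hR]
    exact (norm_deriv_mul_le_of_mapsTo_ball hR (hf.differentiableOn.mono hRU)
      (hm.mono_left hRU)).trans (by linarith [sq_nonneg ‖f z₀‖])
  obtain ⟨u, -, hu, huS⟩ := exists_seq_tendsto_sSup hSne hSb
  choose F hF hFu using huS
  set 𝒰 : Ultrafilter ℕ := hyperfilter ℕ
  obtain ⟨f, hlim⟩ := exists_tendstoLocallyUniformlyOn_of_mapsTo_closedBall 𝒰 hU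
    (fun n ↦ (hF n).1.differentiableOn) (fun n ↦ (hF n).2.mono_right ball_subset_closedBall)
  have hder : ‖deriv f z₀‖ = sSup S := by
    have h1 := ((hlim.deriv (Eventually.of_forall fun n ↦ (hF n).1.differentiableOn)
      hU).tendsto_at hz₀).norm
    refine tendsto_nhds_unique h1 ((hu.mono_left Nat.hyperfilter_le_atTop).congr fun n ↦ ?_)
    exact (hFu n).symm
  -- The supremum is at least |f₀'(z₀)| > 0; this is the nondegeneracy that Hurwitz's theorem needs.
  have hpos : 0 < ‖deriv f z₀‖ := by
    rw [hder]
    exact (norm_pos_iff.2 (hf₀.deriv_ne_zero hU hz₀)).trans_le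
      (le_csSup hSb ⟨f₀, ⟨hf₀, hm₀⟩, rfl⟩)
  have hf : IsConformalOn f U := .of_tendstoLocallyUniformlyOn hlim (fun n ↦ (hF n).1) hU
    hUc.isPathConnected.isConnected.isPreconnected hz₀ (norm_pos_iff.1 hpos)
  refine ⟨f, hf, mapsTo_unitBall_of_mapsTo_closedBall hf hU fun z hz ↦ ?_, fun g hg hgm ↦ ?_⟩
  · exact isClosed_closedBall.mem_of_tendsto (hlim.tendsto_at hz)
      (Eventually.of_forall fun n ↦ ball_subset_closedBall ((hF n).2 hz))
  · rw [hder]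
    exact le_csSup hSb ⟨g, ⟨hg, hgm⟩, rfl⟩

/-- A univalent map into the disk that omits a value is not extremal. -/
theorem exists_norm_deriv_lt_of_notMem_image (hU : IsOpen U) (hUc : IsSimplyConnected U)
    (hf : IsConformalOn f U) (hm : MapsTo f U (ball 0 1)) {z₀ w : ℂ} (hz₀ : z₀ ∈ U)
    (hw : w ∈ ball (0 : ℂ) 1) (hwf : w ∉ f '' U) :
    ∃ g, IsConformalOn g U ∧ MapsTo g U (ball 0 1) ∧ ‖deriv f z₀‖ < ‖deriv g z₀‖ := by
  have hnw := neg_mem_unitBall hw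
  -- Koebe's square root trick: f is the new map followed by `diskAut p`, squaring and `diskAut w`.
  -- This self-map of the disk is not injective, so it strictly contracts the hyperbolic metric.
  set h := diskAut (-w) ∘ f
  have hh : IsConformalOn h U := (isConformalOn_diskAut hnw).comp hf hm
  have hhm : MapsTo h U (ball 0 1) := (mapsTo_diskAut hnw).comp hm
  have hh0 : ∀ z ∈ U, h z ≠ 0 := fun z hz e ↦ hwf ⟨z, hz, by
    rw [← diskAut_diskAut_neg hw (hm hz)]
    change diskAut w (h z) = w
    rw [e, diskAut_zero]⟩
  obtain ⟨s, hsd, hs⟩ := exists_differentiableOn_sq_eq hU hUc hh.differentiableOn hh0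
  have hsc : IsConformalOn s U := .of_sq hh.injOn hsd hs
  have hsm : MapsTo s U (ball 0 1) := fun z hz ↦ by
    have := mem_ball_zero_iff.1 (hhm hz)
    rw [← hs z hz, norm_pow] at this
    exact mem_ball_zero_iff.2 ((pow_lt_one_iff_of_nonneg (norm_nonneg _) two_ne_zero).1 this)
  set p := s z₀
  have hp : p ∈ ball (0 : ℂ) 1 := hsm hz₀
  have hnp := neg_mem_unitBall hp
  refine ⟨diskAut (-p) ∘ s, (isConformalOn_diskAut hnp).comp hsc hsm,
    (mapsTo_diskAut hnp).comp hsm, ?_⟩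
  have hsz := hsc.differentiableAt hU hz₀
  have hp1 := one_sub_norm_sq_pos hp
  have hg : ‖deriv (diskAut (-p) ∘ s) z₀‖ = (1 - ‖p‖ ^ 2)⁻¹ * ‖deriv s z₀‖ := by
    rw [deriv_comp z₀ ((isConformalOn_diskAut hnp).differentiableAt isOpen_ball hp) hsz, norm_mul,
      deriv_diskAut_neg_self hp, Complex.norm_real, Real.norm_of_nonneg (inv_nonneg.2 hp1.le)]
  have hhs : deriv h z₀ = 2 * p * deriv s z₀ := by
    have h1 : HasDerivAt (fun z ↦ s z ^ 2) (2 * p * deriv s z₀) z₀ :=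
      (hsz.hasDerivAt.fun_pow 2).congr_deriv (by simp [p])
    refine (h1.congr_of_eventuallyEq ?_).deriv
    filter_upwards [hU.mem_nhds hz₀] with z hz using (hs z hz).symm
  have hfh : deriv f z₀ = deriv (diskAut w) (h z₀) * deriv h z₀ := by
    rw [← deriv_comp z₀ ((isConformalOn_diskAut hw).differentiableAt isOpen_ball (hhm hz₀))
      (hh.differentiableAt hU hz₀)]
    refine EventuallyEq.deriv_eq ?_
    filter_upwards [hU.mem_nhds hz₀] with z hz using (diskAut_diskAut_neg hw (hm hz)).symm
  have hpick := norm_deriv_mul_le_of_mapsTo_unitBall (differentiableOn_diskAut hw)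
    (mapsTo_diskAut hw) (hhm hz₀)
  rw [← hs z₀ hz₀, norm_pow] at hpick
  have hd : 0 < ‖deriv s z₀‖ := norm_pos_iff.2 (hsc.deriv_ne_zero hU hz₀)
  rw [hg, hfh, hhs, norm_mul, norm_mul, norm_mul, ← hs z₀ hz₀, Complex.norm_ofNat,
    inv_mul_eq_div, lt_div_iff₀ hp1]
  change ‖deriv (diskAut w) (p ^ 2)‖ * (1 - (‖p‖ ^ 2) ^ 2) ≤ _ at hpick
  change ‖deriv (diskAut w) (p ^ 2)‖ * _ * _ < _
  set q := ‖deriv (diskAut w) (p ^ 2)‖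
  have hq : 0 ≤ q := norm_nonneg _
  have hp0 : ‖p‖ < 1 := mem_ball_zero_iff.1 hp
  have hq1 : q * (1 - ‖p‖ ^ 2) * (1 + ‖p‖ ^ 2) ≤ 1 := by
    refine le_trans (le_of_eq ?_) (hpick.trans (sub_le_self _ (by positivity)))
    ring
  -- The strict gain is 2|p| < 1 + |p|².
  have hq2 : q * (1 - ‖p‖ ^ 2) * (2 * ‖p‖) < 1 := by
    rcases hq.eq_or_lt with hq0 | hq0
    · rw [← hq0]; norm_num
    · refine lt_of_lt_of_le (mul_lt_mul_of_pos_left ?_ (mul_pos hq0 hp1)) hq1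
      nlinarith [sq_pos_of_pos (sub_pos.2 hp0)]
  nlinarith [mul_lt_mul_of_pos_right hq2 hd]

/-- The **Riemann mapping theorem**. -/
theorem exists_isConformalOn_image_eq_unitBall (hU : IsOpen U) (hUc : IsSimplyConnected U)
    (hne : U ≠ univ) : ∃ f, IsConformalOn f U ∧ f '' U = ball 0 1 := by
  obtain ⟨z₀, hz₀⟩ := hUc.nonempty
  obtain ⟨f, hf, hm, hmax⟩ := exists_isConformalOn_forall_norm_deriv_le hU hUc hne hz₀
  refine ⟨f, hf, hm.image_subset.antisymm fun w hw ↦ ?_⟩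
  by_contra hwf
  obtain ⟨g, hg, hgm, hlt⟩ := exists_norm_deriv_lt_of_notMem_image hU hUc hf hm hz₀ hw hwf
  exact (hmax g hg hgm).not_gt hlt

end RiemannMapping

/-! ### Logarithmic area and the Bieberbach–Eilenberg coefficient bound. -/

section LogarithmicArea

open Set Metric Filter Topology MeasureTheory
open scoped ENNReal Real

variable {I : Set ℝ} {a b : ℝ}

theorem setLIntegral_norm_preimage_eq {G : ℂ → ℝ≥0∞} (hI : MeasurableSet I) (hI0 : I ⊆ Ioi 0)
    (hG : ContinuousOn G (norm ⁻¹' I)) :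
    ∫⁻ z in norm ⁻¹' I, G z =
      ∫⁻ r in I, ENNReal.ofReal r * ∫⁻ θ in Ioo (-π) π, G (circleMap 0 r θ) := by
  classical
  have hS : MeasurableSet (norm ⁻¹' I : Set ℂ) := measurable_norm hI
  have hmeas : Measurable ((norm ⁻¹' I : Set ℂ).indicator G) := by
    rw [← piecewise_eq_indicator]
    exact hG.measurable_piecewise continuousOn_const hS
  have hpolar : ∀ p : ℝ × ℝ, Complex.polarCoord.symm p = circleMap 0 p.1 p.2 := fun p ↦ by
    rw [Complex.polarCoord_symm_apply, circleMap, zero_add, Complex.exp_mul_I]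
    push_cast; rfl
  rw [← lintegral_indicator hS, ← Complex.lintegral_comp_polarCoord_symm]
  simp only [hpolar, smul_eq_mul]
  rw [show polarCoord.target = Ioi (0 : ℝ) ×ˢ Ioo (-π) π from rfl, Measure.volume_eq_prod,
    ← Measure.prod_restrict, lintegral_prod _ (by
      refine Measurable.aemeasurable (Measurable.mul (by fun_prop) (hmeas.comp ?_))
      simp only [circleMap]
      fun_prop)]
  rw [show (volume.restrict I : Measure ℝ) = (volume.restrict (Ioi 0)).restrict I by
    rw [Measure.restrict_restrict hI, inter_eq_self_of_subset_left hI0], ← lintegral_indicator hI]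
  refine setLIntegral_congr_fun measurableSet_Ioi fun r hr ↦ ?_
  have hmem : ∀ θ, circleMap 0 r θ ∈ (norm ⁻¹' I : Set ℂ) ↔ r ∈ I := fun θ ↦ by
    rw [mem_preimage, norm_circleMap_zero, abs_of_pos hr]
  by_cases hrI : r ∈ I
  · simp only [indicator_of_mem ((hmem _).2 hrI), indicator_of_mem hrI]
    exact lintegral_const_mul' _ _ ENNReal.ofReal_ne_top
  · simp [indicator_of_notMem (fun h ↦ hrI ((hmem _).1 h)), indicator_of_notMem hrI]

theorem setLIntegral_Ioo_two_pi_div (ha : 0 < a) (hab : a ≤ b) :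
    ∫⁻ r in Ioo a b, ENNReal.ofReal (2 * π * r⁻¹) = ENNReal.ofReal (2 * π * Real.log (b / a)) := by
  have hii : IntervalIntegrable (fun r : ℝ ↦ 2 * π * r⁻¹) volume a b := by
    refine ContinuousOn.intervalIntegrable (continuousOn_const.mul (continuousOn_inv₀.mono ?_))
    intro x hx
    rw [uIcc_of_le hab] at hx
    exact (ha.trans_le hx.1).ne'
  rw [← integral_inv_of_pos ha (ha.trans_le hab), ← intervalIntegral.integral_const_mul,
    intervalIntegral.integral_of_le hab, ← restrict_Ioo_eq_restrict_Ioc,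
    ofReal_integral_eq_lintegral_ofReal]
  · exact (hii.1.mono_set Ioo_subset_Ioc_self)
  · refine (ae_restrict_iff' measurableSet_Ioo).2 (ae_of_all _ fun r hr ↦ ?_)
    have := ha.trans hr.1
    positivity

theorem setLIntegral_annulus_inv_norm_sq (ha : 0 < a) (hab : a ≤ b) :
    ∫⁻ w in (norm ⁻¹' Icc a b : Set ℂ), ENNReal.ofReal (‖w‖ ^ 2)⁻¹ =
      ENNReal.ofReal (2 * π * Real.log (b / a)) := by
  have hpos : Icc a b ⊆ Ioi 0 := fun r hr ↦ lt_of_lt_of_le ha hr.1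
  rw [setLIntegral_norm_preimage_eq measurableSet_Icc hpos,
    ← setLIntegral_Ioo_two_pi_div ha hab,
    show volume.restrict (Ioo a b) = volume.restrict (Icc a b) from restrict_Ioo_eq_restrict_Icc]
  · refine setLIntegral_congr_fun measurableSet_Icc fun r hr ↦ ?_
    have hr0 : 0 < r := ha.trans_le hr.1
    simp only [norm_circleMap_zero, abs_of_pos hr0, setLIntegral_const, Real.volume_Ioo]
    rw [← ENNReal.ofReal_mul (by positivity), ← ENNReal.ofReal_mul hr0.le]
    congr 1
    field_simp
    ring
  · refine ENNReal.continuous_ofReal.comp_continuousOn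
      (ContinuousOn.inv₀ (by fun_prop) fun w hw ↦ ?_)
    have : 0 < ‖w‖ := ha.trans_le hw.1
    positivity

/-- The mean of q over the circle is q(0) = 1, and |q|² ≥ 2 Re q - 1. -/
theorem two_pi_le_setLIntegral_circleMap {q : ℂ → ℂ} {r : ℝ} (hr : 0 < r)
    (hq : DifferentiableOn ℂ q (closedBall 0 r)) (hq0 : q 0 = 1) :
    ENNReal.ofReal (2 * π) ≤
      ∫⁻ θ in Ioo (-π) π, ENNReal.ofReal (‖q (circleMap 0 r θ)‖ ^ 2) := by
  have hmem : ∀ θ, circleMap 0 r θ ∈ closedBall (0 : ℂ) r := fun θ ↦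
    circleMap_mem_closedBall 0 hr.le θ
  have hqc : Continuous fun θ ↦ q (circleMap 0 r θ) :=
    hq.continuousOn.comp_continuous (continuous_circleMap 0 r) hmem
  have hmean : ∫ θ in (-π)..π, q (circleMap 0 r θ) = 2 * π := by
    have h1 := DiffContOnCl.circleAverage (f := q) (c := 0) (R := r)
      (by rw [abs_of_pos hr]; exact hq.diffContOnCl_ball Subset.rfl)
    rw [hq0, Real.circleAverage_def, Complex.real_smul] at h1
    have h2 := (Function.Periodic.comp (periodic_circleMap 0 r) q).intervalIntegral_add_eq (-π) 0
    rw [show -π + 2 * π = π by ring, zero_add] at h2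
    simp only [Function.comp_def] at h2
    rw [h2]
    have h3 : ((2 * π : ℝ) : ℂ) ≠ 0 := Complex.ofReal_ne_zero.2 (by positivity)
    rw [Complex.ofReal_inv, inv_mul_eq_iff_eq_mul₀ h3, mul_one] at h1
    rw [h1]; push_cast; ring
  have hre : ∫ θ in (-π)..π, (q (circleMap 0 r θ)).re = 2 * π := by
    have h := Complex.reCLM.intervalIntegral_comp_comm (hqc.intervalIntegrable (μ := volume) (-π) π)
    simp only [Complex.reCLM_apply] at h
    rw [h, hmean]
    simp
  have hle : -π ≤ π := by linarith [Real.pi_pos]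
  have hrec : Continuous fun θ ↦ (q (circleMap 0 r θ)).re := Complex.continuous_re.comp hqc
  have hsq : Continuous fun θ ↦ ‖q (circleMap 0 r θ)‖ ^ 2 := hqc.norm.pow 2
  have hlow : 2 * π ≤ ∫ θ in (-π)..π, ‖q (circleMap 0 r θ)‖ ^ 2 := by
    have hcre : Continuous fun θ ↦ 2 * (q (circleMap 0 r θ)).re - 1 :=
      (continuous_const.mul hrec).sub continuous_const
    calc 2 * π = ∫ θ in (-π)..π, (2 * (q (circleMap 0 r θ)).re - 1) := by
          rw [intervalIntegral.integral_sub ((hrec.intervalIntegrable _ _).const_mul 2)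
            (by simp), intervalIntegral.integral_const_mul, hre, intervalIntegral.integral_const,
            smul_eq_mul]
          ring
      _ ≤ _ := by
          refine intervalIntegral.integral_mono_on hle (hcre.intervalIntegrable _ _)
            (hsq.intervalIntegrable _ _) fun θ _ ↦ ?_
          rw [← Complex.normSq_eq_norm_sq, Complex.normSq_apply]
          nlinarith [sq_nonneg ((q (circleMap 0 r θ)).re - 1),
            sq_nonneg (q (circleMap 0 r θ)).im]
  refine (ENNReal.ofReal_le_ofReal hlow).trans_eq ?_
  rw [intervalIntegral.integral_of_le hle, ← restrict_Ioo_eq_restrict_Ioc,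
    ofReal_integral_eq_lintegral_ofReal]
  · exact (hsq.integrableOn_Icc (μ := volume)).mono_set Ioo_subset_Icc_self
  · exact ae_of_all _ fun θ ↦ by positivity

theorem ofReal_log_le_setLIntegral_annulus {q : ℂ → ℂ} (ha : 0 < a) (hab : a ≤ b) (hb : b ≤ 1)
    (hq : DifferentiableOn ℂ q (ball 0 1)) (hq0 : q 0 = 1) :
    ENNReal.ofReal (2 * π * Real.log (b / a)) ≤
      ∫⁻ z in (norm ⁻¹' Ioo a b : Set ℂ), ENNReal.ofReal (‖q z‖ ^ 2 * (‖z‖ ^ 2)⁻¹) := by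
  rw [setLIntegral_norm_preimage_eq measurableSet_Ioo (fun r hr ↦ ha.trans hr.1),
    ← setLIntegral_Ioo_two_pi_div ha hab]
  · refine setLIntegral_mono' measurableSet_Ioo fun r hr ↦ ?_
    have hr0 : 0 < r := ha.trans hr.1
    simp only [norm_circleMap_zero, abs_of_pos hr0]
    simp only [ENNReal.ofReal_mul' (show 0 ≤ (r ^ 2)⁻¹ by positivity)]
    rw [lintegral_mul_const' _ _ ENNReal.ofReal_ne_top]
    calc ENNReal.ofReal (2 * π * r⁻¹)
        = ENNReal.ofReal r * (ENNReal.ofReal (2 * π) * ENNReal.ofReal (r ^ 2)⁻¹) := by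
          rw [← ENNReal.ofReal_mul (by positivity), ← ENNReal.ofReal_mul hr0.le]
          congr 1
          field_simp
      _ ≤ _ := by
          gcongr
          exact two_pi_le_setLIntegral_circleMap hr0
            (hq.mono (closedBall_subset_ball (hr.2.trans_le hb))) hq0
  · refine ENNReal.continuous_ofReal.comp_continuousOn (ContinuousOn.mul
      ((hq.continuousOn.mono fun z hz ↦ ?_).norm.pow 2)
      (ContinuousOn.inv₀ (by fun_prop) fun w hw ↦ ?_))
    · exact mem_ball_zero_iff.2 (hz.2.trans_le hb)
    · have : 0 < ‖w‖ := ha.trans hw.1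
      positivity

theorem abs_det_restrictScalars_toSpanSingleton (c : ℂ) :
    |((ContinuousLinearMap.toSpanSingleton ℂ c).restrictScalars ℝ).det| = ‖c‖ ^ 2 := by
  simp [ContinuousLinearMap.det, LinearMap.det_restrictScalars, Algebra.norm_complex_eq,
    Complex.normSq_eq_norm_sq]

theorem IsConformalOn.lintegral_image {f : ℂ → ℂ} {D S : Set ℂ} (hf : IsConformalOn f D)
    (hD : IsOpen D) (hS : MeasurableSet S) (hSD : S ⊆ D) (G : ℂ → ℝ≥0∞) :
    ∫⁻ w in f '' S, G w = ∫⁻ z in S, ENNReal.ofReal (‖deriv f z‖ ^ 2) * G (f z) := by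
  rw [lintegral_image_eq_lintegral_abs_det_fderiv_mul volume hS
    (f' := fun z ↦ (ContinuousLinearMap.toSpanSingleton ℂ (deriv f z)).restrictScalars ℝ)
    (fun z hz ↦ ?_) (hf.injOn.mono hSD)]
  · simp only [abs_det_restrictScalars_toSpanSingleton]
  · exact ((hf.differentiableAt hD (hSD hz)).hasDerivAt.hasFDerivAt.restrictScalars
      ℝ).hasFDerivWithinAt

/-- The element dA/|w|² pulls back to |f'/f|² dA. Only the modulus of f'/f is prescribed, so the
same q serves H and 1/H, whose logarithmic derivatives differ in sign. -/
theorem ofReal_log_le_setLIntegral_image {f q : ℂ → ℂ} {D : Set ℂ} (ha : 0 < a) (hab : a ≤ b)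
    (hb : b ≤ 1) (hq : DifferentiableOn ℂ q (ball 0 1)) (hq0 : q 0 = 1) (hD : IsOpen D)
    (hf : IsConformalOn f D) (hI : norm ⁻¹' Ioo a b ⊆ D)
    (hfq : ∀ z ∈ (norm ⁻¹' Ioo a b : Set ℂ), ‖deriv f z‖ / ‖f z‖ = ‖q z‖ / ‖z‖) :
    ENNReal.ofReal (2 * π * Real.log (b / a)) ≤
      ∫⁻ w in f '' (norm ⁻¹' Ioo a b), ENNReal.ofReal (‖w‖ ^ 2)⁻¹ := by
  have hS : MeasurableSet (norm ⁻¹' Ioo a b : Set ℂ) := measurable_norm measurableSet_Ioo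
  rw [hf.lintegral_image hD hS hI]
  refine (ofReal_log_le_setLIntegral_annulus ha hab hb hq hq0).trans_eq ?_
  refine setLIntegral_congr_fun hS fun z hz ↦ ?_
  rw [← ENNReal.ofReal_mul (by positivity), ← div_eq_mul_inv, ← div_eq_mul_inv, ← div_pow,
    ← div_pow, hfq z hz]

variable {H : ℂ → ℂ}

/-- The zero of H at 0 is simple and is the only one, so zH'/H extends holomorphically with value 1
at 0. -/
theorem exists_logDeriv_eq_div (hH : IsConformalOn H (ball 0 1)) (h0 : H 0 = 0) :
    ∃ q : ℂ → ℂ, DifferentiableOn ℂ q (ball 0 1) ∧ q 0 = 1 ∧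
      ∀ z ∈ ball (0 : ℂ) 1, z ≠ 0 → deriv H z / H z = q z / z := by
  have h0m : (0 : ℂ) ∈ ball (0 : ℂ) 1 := mem_ball_self one_pos
  have hne : ∀ z ∈ ball (0 : ℂ) 1, dslope H 0 z ≠ 0 := by
    intro z hz
    rcases eq_or_ne z 0 with rfl | hz0
    · rw [dslope_same]; exact hH.deriv_ne_zero isOpen_ball hz
    · rw [dslope_of_ne _ hz0, slope_def_field, h0, sub_zero, sub_zero]
      exact div_ne_zero (fun e ↦ hz0 (hH.injOn hz h0m (e.trans h0.symm))) hz0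
  refine ⟨fun z ↦ deriv H z / dslope H 0 z, (hH.differentiableOn.deriv isOpen_ball).div
    ((Complex.differentiableOn_dslope (isOpen_ball.mem_nhds h0m)).2 hH.differentiableOn) hne,
    ?_, fun z hz hz0 ↦ ?_⟩
  · simp only [dslope_same]
    rw [div_self (hH.deriv_ne_zero isOpen_ball h0m)]
  · simp only [dslope_of_ne _ hz0, slope_def_field, h0, sub_zero]
    rw [div_div, div_mul_cancel₀ _ hz0]

/-- On r < |z| < s, injectivity gives |H| ≥ ρ, since smaller values are taken in |z| < r; in the
same way H(z)H(w) ≠ 1 gives |H| ≤ 1/ρ. Comparing logarithmic areas, 2 log(s/r) ≤ log(1/ρ²), that is,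
s ≤ r/ρ. -/
theorem radius_le_of_ball_subset_image (hH : IsConformalOn H (ball 0 1)) (h0 : H 0 = 0)
    (hBE : ∀ z ∈ ball (0 : ℂ) 1, ∀ w ∈ ball (0 : ℂ) 1, H z * H w ≠ 1) {ρ r : ℝ} (hr : 0 < r)
    (hr1 : r < 1) (hρ : ball 0 ρ ⊆ H '' ball 0 r) : ρ ≤ r := by
  by_contra! hlt
  have hρ0 : 0 < ρ := hr.trans hlt
  -- Room for s > r/ρ below 1 exists exactly because r < ρ; the area estimate will contradict it.
  obtain ⟨s, hs, hs1⟩ := exists_between (show max r (r / ρ) < 1 from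
    max_lt hr1 ((div_lt_one hρ0).2 hlt))
  have hrs : r < s := (le_max_left _ _).trans_lt hs
  have h0m : (0 : ℂ) ∈ ball (0 : ℂ) 1 := mem_ball_self one_pos
  obtain ⟨q, hq, hq0, hHq⟩ := exists_logDeriv_eq_div hH h0
  set A : Set ℂ := norm ⁻¹' Ioo r s
  have hAo : IsOpen A := isOpen_Ioo.preimage continuous_norm
  have hAb : A ⊆ ball 0 1 := fun z hz ↦ mem_ball_zero_iff.2 (hz.2.trans hs1)
  have hA0 : ∀ z ∈ A, z ≠ 0 := fun z hz e ↦ by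
    have : r < ‖z‖ := hz.1
    rw [e, norm_zero] at this
    exact this.not_gt hr
  have hHA0 : ∀ z ∈ A, H z ≠ 0 := fun z hz e ↦
    hA0 z hz (hH.injOn (hAb hz) h0m (e.trans h0.symm))
  have hHA : IsConformalOn H A := hH.mono hAb
  have hK : IsConformalOn (fun z ↦ (H z)⁻¹) A :=
    ⟨hHA.differentiableOn.inv hHA0, fun z hz w hw e ↦ hHA.injOn hz hw (inv_injective e)⟩
  have hHq' : ∀ z ∈ A, ‖deriv H z‖ / ‖H z‖ = ‖q z‖ / ‖z‖ := fun z hz ↦ by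
    rw [← norm_div, hHq z (hAb hz) (hA0 z hz), norm_div]
  have hKq : ∀ z ∈ A, ‖deriv (fun z ↦ (H z)⁻¹) z‖ / ‖(H z)⁻¹‖ = ‖q z‖ / ‖z‖ := fun z hz ↦ by
    rw [← hHq' z hz, deriv_fun_inv'' (hHA.differentiableAt hAo hz) (hHA0 z hz), norm_div, norm_neg,
      norm_inv, norm_pow]
    have := norm_ne_zero_iff.2 (hHA0 z hz)
    field_simp
  have hlow : ∀ z ∈ A, ρ ≤ ‖H z‖ := fun z hz ↦ by
    by_contra! hlt'
    obtain ⟨x, hx, hxz⟩ := hρ (mem_ball_zero_iff.2 hlt')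
    rw [hH.injOn (ball_subset_ball hr1.le hx) (hAb hz) hxz] at hx
    exact (mem_ball_zero_iff.1 hx).not_gt hz.1
  have hup : ∀ z ∈ A, ‖H z‖ ≤ ρ⁻¹ := fun z hz ↦ by
    by_contra! hlt'
    obtain ⟨x, hx, hxz⟩ := hρ (mem_ball_zero_iff.2 (show ‖(H z)⁻¹‖ < ρ by
      rw [norm_inv]; exact inv_lt_of_inv_lt₀ hρ0 hlt'))
    exact hBE z (hAb hz) x (ball_subset_ball hr1.le hx)
      (by rw [hxz, mul_inv_cancel₀ (hHA0 z hz)])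
  have hsub : H '' A ∪ (fun z ↦ (H z)⁻¹) '' A ⊆ norm ⁻¹' Icc ρ ρ⁻¹ := by
    rintro _ (⟨z, hz, rfl⟩ | ⟨z, hz, rfl⟩)
    · exact ⟨hlow z hz, hup z hz⟩
    · simp only [mem_preimage, norm_inv]
      exact ⟨le_inv_of_le_inv₀ (hρ0.trans_le (hlow z hz)) (hup z hz),
        inv_anti₀ hρ0 (hlow z hz)⟩
  have hdisj : Disjoint (H '' A) ((fun z ↦ (H z)⁻¹) '' A) := by
    rw [disjoint_left]
    rintro _ ⟨z, hz, rfl⟩ ⟨w, hw, hwz⟩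
    exact hBE z (hAb hz) w (hAb hw) (by rw [← hwz, inv_mul_cancel₀ (hHA0 w hw)])
  have hρρ : ρ ≤ ρ⁻¹ := by
    obtain ⟨t, ht1, ht2⟩ := exists_between hrs
    have htA : (t : ℂ) ∈ A := by
      change ‖(t : ℂ)‖ ∈ Ioo r s
      rw [Complex.norm_real, Real.norm_of_nonneg (hr.trans ht1).le]
      exact ⟨ht1, ht2⟩
    exact (hlow _ htA).trans (hup _ htA)
  have harea := (add_le_add
    (ofReal_log_le_setLIntegral_image hr hrs.le hs1.le hq hq0 hAo hHA Subset.rfl hHq')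
    (ofReal_log_le_setLIntegral_image hr hrs.le hs1.le hq hq0 hAo hK Subset.rfl hKq)).trans
    (((lintegral_union (hK.isOpen_image hAo).measurableSet hdisj).symm.le.trans
      (lintegral_mono_set hsub)).trans_eq (setLIntegral_annulus_inv_norm_sq hρ0 hρρ))
  have hlog : 0 < Real.log (s / r) := Real.log_pos ((one_lt_div hr).2 hrs)
  have hpi := Real.pi_pos
  rw [← ENNReal.ofReal_add (by positivity) (by positivity),
    ENNReal.ofReal_le_ofReal_iff' ] at harea
  have hle : 2 * Real.log (s / r) ≤ Real.log (ρ⁻¹ / ρ) := by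
    rcases harea with h | h
    · have h2 : 2 * π * (2 * Real.log (s / r)) ≤ 2 * π * Real.log (ρ⁻¹ / ρ) := by linarith
      exact le_of_mul_le_mul_left h2 (by positivity)
    · have : 0 < 2 * π * Real.log (s / r) := by positivity
      linarith
  rw [div_eq_mul_inv ρ⁻¹, ← sq, Real.log_pow, Nat.cast_ofNat,
    mul_le_mul_iff_right₀ two_pos, Real.log_le_log_iff (div_pos (hr.trans hrs) hr)
    (inv_pos.2 hρ0), div_le_iff₀ hr, inv_mul_eq_div] at hle
  exact ((le_max_right _ _).trans_lt hs).not_ge hle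

/-- The coefficient bound for univalent Bieberbach–Eilenberg functions. -/
theorem norm_deriv_zero_le_one_of_mul_ne_one (hH : IsConformalOn H (ball 0 1)) (h0 : H 0 = 0)
    (hBE : ∀ z ∈ ball (0 : ℂ) 1, ∀ w ∈ ball (0 : ℂ) 1, H z * H w ≠ 1) : ‖deriv H 0‖ ≤ 1 := by
  by_contra! hgt
  have h0m : (0 : ℂ) ∈ ball (0 : ℂ) 1 := mem_ball_self one_pos
  obtain ⟨g, hg⟩ : ∃ g, LeftInvOn g H (ball 0 1) := ⟨_, hH.injOn.leftInvOn_invFunOn⟩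
  have hgd := hH.differentiableAt_of_leftInvOn isOpen_ball hg h0m
  have hmul := hH.deriv_mul_deriv_of_leftInvOn isOpen_ball hg h0m
  have hg0 : g 0 = 0 := by simpa [h0] using hg h0m
  rw [h0] at hgd hmul
  have hlt : ‖deriv g 0‖ < 1 := by
    rw [eq_inv_of_mul_eq_one_left hmul, norm_inv]
    exact inv_lt_one_of_one_lt₀ hgt
  -- The inverse contracts by c near 0, so a small disk of radius ρ is covered by the image of the
  -- disk of radius cρ < ρ.
  obtain ⟨c, hc, hc1⟩ := exists_between hlt
  have hc0 : 0 < c := (norm_nonneg _).trans_lt hc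
  have hbound : ∀ᶠ w in 𝓝 0, ‖g w‖ ≤ c * ‖w‖ := by
    have h1 := hgd.hasDerivAt.isLittleO.def (sub_pos.2 hc)
    filter_upwards [h1] with w hw
    simp only [hg0, sub_zero, smul_eq_mul] at hw
    calc ‖g w‖ = ‖(g w - w * deriv g 0) + w * deriv g 0‖ := by ring_nf
      _ ≤ (c - ‖deriv g 0‖) * ‖w‖ + ‖w‖ * ‖deriv g 0‖ :=
        (norm_add_le _ _).trans (add_le_add hw (norm_mul _ _).le)
      _ = c * ‖w‖ := by ring
  have himg : H '' ball 0 1 ∈ 𝓝 (0 : ℂ) :=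
    (hH.isOpen_image isOpen_ball).mem_nhds ⟨0, h0m, h0⟩
  obtain ⟨ρ, hρ, hball⟩ := Metric.eventually_nhds_iff_ball.1 (hbound.and himg)
  have hsmall : min ρ 1 ≤ c * min ρ 1 := by
    refine radius_le_of_ball_subset_image hH h0 hBE (by positivity)
      ((mul_le_of_le_one_right hc0.le (min_le_right _ _)).trans_lt hc1) fun w hw ↦ ?_
    obtain ⟨hgw, x, hx, hxw⟩ := hball w (ball_subset_ball (min_le_left _ _) hw)
    rw [← hxw, hg hx, hxw] at hgw
    refine ⟨x, mem_ball_zero_iff.2 (hgw.trans_lt ?_), hxw⟩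
    exact mul_lt_mul_of_pos_left (mem_ball_zero_iff.1 hw) hc0
  have : 0 < min ρ 1 := by positivity
  nlinarith

end LogarithmicArea

/-! ### From the coefficient bound to the quarter theorem. -/

section KoebeQuarter

open Set Metric

theorem isSimplyConnected_ball {E : Type*} [NormedAddCommGroup E] [NormedSpace ℝ E] (c : E)
    {r : ℝ} (hr : 0 < r) : IsSimplyConnected (ball c r) := by
  have : ContractibleSpace (ball c r) :=
    (convex_ball c r).contractibleSpace ⟨c, mem_ball_self hr⟩
  exact inferInstanceAs (SimplyConnectedSpace (ball c r))

/-- The **Koebe quarter theorem**, for univalent functions that omit `0`. -/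
theorem norm_deriv_zero_le_of_ne_zero {F : ℂ → ℂ} (hF : IsConformalOn F (ball 0 1))
    (hne : ∀ z ∈ ball (0 : ℂ) 1, F z ≠ 0) : ‖deriv F 0‖ ≤ 4 * ‖F 0‖ := by
  have h0m : (0 : ℂ) ∈ ball (0 : ℂ) 1 := mem_ball_self one_pos
  obtain ⟨G, hGd, hG⟩ := exists_differentiableOn_sq_eq isOpen_ball
    (isSimplyConnected_ball (0 : ℂ) one_pos) hF.differentiableOn hne
  have hGc : IsConformalOn G (ball 0 1) := .of_sq hF.injOn hGd hG
  have hG0 : ∀ z ∈ ball (0 : ℂ) 1, G z ≠ 0 := fun z hz e ↦ hne z hz (by rw [← hG z hz, e]; ring)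
  have hGG : ∀ z ∈ ball (0 : ℂ) 1, ∀ w ∈ ball (0 : ℂ) 1, G z + G w ≠ 0 := by
    intro z hz w hw e
    have e' : G z = -G w := eq_neg_of_add_eq_zero_left e
    have hzw : z = w := hF.injOn hz hw (by rw [← hG z hz, ← hG w hw, e', neg_sq])
    rw [hzw, ← two_mul] at e
    exact hG0 w hw ((mul_eq_zero.1 e).resolve_left two_ne_zero)
  set c := G 0
  have hc : c ≠ 0 := hG0 0 h0m
  have hden : ∀ z ∈ ball (0 : ℂ) 1, G z + c ≠ 0 := fun z hz ↦ hGG z hz 0 h0m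
  -- This Möbius map sends c to 0 and turns opposite values into reciprocal ones.
  set H : ℂ → ℂ := fun z ↦ (G z - c) / (G z + c)
  have hH : IsConformalOn H (ball 0 1) := by
    refine ⟨(hGd.sub_const c).div (hGd.add_const c) hden, fun z hz w hw e ↦ hGc.injOn hz hw ?_⟩
    have e' := (div_eq_div_iff (hden z hz) (hden w hw)).1 e
    have : 2 * c * (G z - G w) = 0 := by linear_combination e'
    exact sub_eq_zero.1 ((mul_eq_zero.1 this).resolve_left (mul_ne_zero two_ne_zero hc))
  have hBE : ∀ z ∈ ball (0 : ℂ) 1, ∀ w ∈ ball (0 : ℂ) 1, H z * H w ≠ 1 := by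
    intro z hz w hw e
    rw [div_mul_div_comm, div_eq_one_iff_eq (mul_ne_zero (hden z hz) (hden w hw))] at e
    have : 2 * c * (G z + G w) = 0 := by linear_combination -e
    exact hGG z hz w hw ((mul_eq_zero.1 this).resolve_left (mul_ne_zero two_ne_zero hc))
  have hbound := norm_deriv_zero_le_one_of_mul_ne_one hH (by simp [H, c]) hBE
  have hGda := hGc.differentiableAt isOpen_ball h0m
  have hHd : deriv H 0 = deriv G 0 / (2 * c) := by
    refine ((hGda.hasDerivAt.sub_const c).fun_div (hGda.hasDerivAt.add_const c)
      (hden 0 h0m)).deriv.trans ?_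
    change (_ * (c + c) - (c - c) * _) / (c + c) ^ 2 = _
    field_simp
    ring
  have hFd : deriv F 0 = 2 * c * deriv G 0 := by
    refine (((hGda.hasDerivAt.fun_pow 2).congr_deriv (by simp [c])).congr_of_eventuallyEq
      ?_).deriv
    filter_upwards [isOpen_ball.mem_nhds h0m] with z hz using (hG z hz).symm
  have hcn : 0 < ‖c‖ := norm_pos_iff.2 hc
  rw [hHd, norm_div, norm_mul, Complex.norm_ofNat, div_le_one (by positivity)] at hbound
  rw [hFd, ← hG 0 h0m, norm_mul, norm_mul, norm_pow, Complex.norm_ofNat]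
  change _ ≤ 4 * ‖c‖ ^ 2
  nlinarith

end KoebeQuarter

/-! ### Coverings of simply connected regions and the hyperbolic density. -/

section Coverings

open Set Metric

/-- The identity of the base lifts to a section s through x. Both s ∘ p and the identity lift p and
agree at x, so s is a left inverse of p. -/
theorem IsCoveringMap.injective_of_simplyConnectedSpace {E X : Type*} [TopologicalSpace E]
    [TopologicalSpace X] [PreconnectedSpace E] [SimplyConnectedSpace X]
    [LocallyPathConnectedSpace X] {p : E → X} (hp : IsCoveringMap p) : Function.Injective p := by
  intro x y hxy
  obtain ⟨s, ⟨hsx, hs⟩, -⟩ :=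
    hp.existsUnique_continuousMap_lifts (ContinuousMap.id X) (p x) x rfl
  have h : s ∘ p = id := hp.eq_of_comp_eq (s.continuous.comp hp.continuous) continuous_id
    (by rw [← Function.comp_assoc, hs]; rfl) x hsx
  rw [← id_eq x, ← id_eq y, ← h, Function.comp_apply, Function.comp_apply, hxy]

theorem Homeomorph.isCoveringMap {E X : Type*} [TopologicalSpace E] [TopologicalSpace X]
    (e : E ≃ₜ X) : IsCoveringMap e := fun _ ↦
  IsEvenlyCovered.to_isEvenlyCovered_preimage (I := Unit)
    ⟨inferInstance, univ, mem_univ _, isOpen_univ, isOpen_univ,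
      (Homeomorph.Set.univ E).trans (e.trans ((Homeomorph.Set.univ X).symm.trans
        (Homeomorph.prodUnique _ Unit).symm)), fun _ ↦ rfl⟩

variable {g : ℂ → ℂ} {D : Set ℂ}

theorem IsDiskCovering.image_eq (hg : IsDiskCovering g D) : g '' ball 0 1 = D :=
  hg.exists_isCoveringMap.1.image_subset.antisymm hg.surjOn

theorem IsDiskCovering.isConformalOn (hg : IsDiskCovering g D) (hD : IsOpen D)
    (hDc : IsSimplyConnected D) : IsConformalOn g (ball 0 1) := by
  obtain ⟨hm, hcov⟩ := hg.exists_isCoveringMap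
  have := hDc.simplyConnectedSpace
  have := hD.locallyPathConnectedSpace
  have : PreconnectedSpace (ball (0 : ℂ) 1) :=
    isPreconnected_iff_preconnectedSpace.1 (convex_ball 0 1).isPreconnected
  refine ⟨hg.differentiableOn, fun z hz w hw h ↦ ?_⟩
  exact congrArg Subtype.val (hcov.injective_of_simplyConnectedSpace
    (a₁ := ⟨z, hz⟩) (a₂ := ⟨w, hw⟩) (Subtype.ext h))

theorem IsConformalOn.isDiskCovering (hg : IsConformalOn g (ball 0 1)) :
    IsDiskCovering g (g '' ball 0 1) := by
  refine ⟨hg.differentiableOn, surjOn_image _ _, mapsTo_image _ _, ?_⟩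
  set k := Function.invFunOn g (ball 0 1)
  have hk : LeftInvOn k g (ball 0 1) := hg.injOn.leftInvOn_invFunOn
  have hkm : MapsTo k (g '' ball 0 1) (ball 0 1) := by
    rintro _ ⟨z, hz, rfl⟩
    rwa [hk hz]
  let e : ball (0 : ℂ) 1 ≃ₜ g '' ball 0 1 :=
    { toFun := (mapsTo_image g (ball 0 1)).restrict
      invFun := hkm.restrict
      left_inv := fun z ↦ Subtype.ext (hk z.2)
      right_inv := by
        rintro ⟨_, z, hz, rfl⟩
        exact Subtype.ext (congrArg g (hk hz))
      continuous_toFun := hg.differentiableOn.continuousOn.mapsToRestrict _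
      continuous_invFun := (hg.of_leftInvOn isOpen_ball hk).differentiableOn.continuousOn.mapsToRestrict
        _ }
  exact e.isCoveringMap

/-- On a simply connected region the hyperbolic density is computed from a Riemann map. -/
theorem exists_hyperbolicDensity_eq (hD : IsOpen D) (hDc : IsSimplyConnected D) (hne : D ≠ univ)
    {w : ℂ} (hw : w ∈ D) :
    ∃ g ζ, IsConformalOn g (ball 0 1) ∧ g '' ball 0 1 = D ∧ ζ ∈ ball (0 : ℂ) 1 ∧ g ζ = w ∧
      hyperbolicDensity D w = 1 / ((1 - ‖ζ‖ ^ 2) * ‖deriv g ζ‖) := by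
  obtain ⟨f, hf, hfD⟩ := exists_isConformalOn_image_eq_unitBall hD hDc hne
  -- The inverse Riemann map is a witness, which rules out the default value 0. The chosen covering
  -- may be another one, but it is injective too.
  have hex : ∃ p : (ℂ → ℂ) × ℂ, IsDiskCovering p.1 D ∧ p.2 ∈ ball (0 : ℂ) 1 ∧ p.1 p.2 = w := by
    set k := Function.invFunOn f D
    have hk : LeftInvOn k f D := hf.injOn.leftInvOn_invFunOn
    have hkc := hf.of_leftInvOn hD hk
    rw [hfD] at hkc
    refine ⟨(k, f w), ?_, hfD ▸ mem_image_of_mem f hw, hk hw⟩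
    have := hkc.isDiskCovering
    rwa [← hfD, hk.image_image] at this
  refine ⟨hex.choose.1, hex.choose.2, hex.choose_spec.1.isConformalOn hD hDc,
    hex.choose_spec.1.image_eq, hex.choose_spec.2.1, hex.choose_spec.2.2, ?_⟩
  rw [hyperbolicDensity, dif_pos hex]

theorem unitBall_ne_univ : ball (0 : ℂ) 1 ≠ univ := fun h ↦ by
  have : (1 : ℂ) ∈ ball (0 : ℂ) 1 := h ▸ mem_univ _
  simp at this

/-- The chosen covering is an automorphism of the disk; Schwarz–Pick for it and for its inverse
forces equality. -/
theorem hyperbolicDensity_unitBall {z : ℂ} (hz : z ∈ ball (0 : ℂ) 1) :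
    hyperbolicDensity (ball 0 1) z = 1 / (1 - ‖z‖ ^ 2) := by
  obtain ⟨g, ζ, hg, hgD, hζ, rfl, hden⟩ := exists_hyperbolicDensity_eq isOpen_ball
    (isSimplyConnected_ball (0 : ℂ) one_pos) unitBall_ne_univ hz
  set k := Function.invFunOn g (ball 0 1)
  have hk : LeftInvOn k g (ball 0 1) := hg.injOn.leftInvOn_invFunOn
  have hkc := hg.of_leftInvOn isOpen_ball hk
  have hkm : MapsTo k (ball 0 1) (ball 0 1) := by
    rw [mapsTo_iff_image_subset]
    conv_lhs => rw [← hgD, hk.image_image]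
  rw [hgD] at hkc
  have h1 := norm_deriv_mul_le_of_mapsTo_unitBall hg.differentiableOn
    (mapsTo_iff_image_subset.2 hgD.le) hζ
  have h2 := norm_deriv_mul_le_of_mapsTo_unitBall hkc.differentiableOn hkm hz
  have h3 := congrArg norm (hg.deriv_mul_deriv_of_leftInvOn isOpen_ball hk hζ)
  rw [hk hζ] at h2
  rw [norm_mul, norm_one] at h3
  have h4 : (1 - ‖g ζ‖ ^ 2) ≤ (1 - ‖ζ‖ ^ 2) * ‖deriv g ζ‖ := by
    calc 1 - ‖g ζ‖ ^ 2 = ‖deriv k (g ζ)‖ * (1 - ‖g ζ‖ ^ 2) * ‖deriv g ζ‖ := by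
          rw [mul_right_comm, h3, one_mul]
      _ ≤ _ := by gcongr
  rw [hden, le_antisymm (by linarith) h4]

end Coverings

/-! ### Distance to the boundary of the image. -/

section BoundaryDistance

open Set Metric

variable {F : ℂ → ℂ} {D : Set ℂ}

/-- The ball is connected and misses the frontier. With an empty frontier `infDist` is 0 and the
ball is empty. -/
theorem ball_boundaryDist_subset (hD : IsOpen D) {z : ℂ} (hz : z ∈ D) :
    ball z (boundaryDist D z) ⊆ D := by
  rcases (ball z (boundaryDist D z)).eq_empty_or_nonempty with he | hne
  · rw [he]; exact empty_subset D
  · refine (convex_ball z _).isPreconnected.subset_of_closure_inter_subset hD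
      ⟨z, mem_ball_self (nonempty_ball.1 hne), hz⟩ fun w ⟨hwD, hw⟩ ↦ ?_
    by_contra hwn
    have hfr : w ∈ frontier D := by rw [hD.frontier_eq]; exact ⟨hwD, hwn⟩
    exact ((infDist_le_dist_of_mem hfr).trans_eq (dist_comm z w)).not_gt (mem_ball.1 hw)

/-- Otherwise the inverse would be a bounded entire function, against Liouville. -/
theorem IsConformalOn.image_unitBall_ne_univ (hF : IsConformalOn F (ball 0 1)) :
    F '' ball 0 1 ≠ univ := by
  intro h
  set k := Function.invFunOn F (ball 0 1)
  have hk : LeftInvOn k F (ball 0 1) := hF.injOn.leftInvOn_invFunOn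
  have hkc := hF.of_leftInvOn isOpen_ball hk
  have hrange : range k = ball 0 1 := by rw [← image_univ, ← h, hk.image_image]
  rw [h] at hkc
  have hconst := (differentiableOn_univ.1 hkc.differentiableOn).apply_eq_apply_of_bounded
    (hrange ▸ isBounded_ball)
  have h0 : (0 : ℂ) ∈ ball (0 : ℂ) 1 := mem_ball_self one_pos
  have h1 : (1 / 2 : ℂ) ∈ ball (0 : ℂ) 1 := by
    rw [mem_ball_zero_iff]; norm_num
  have := hconst (F 0) (F (1 / 2))
  rw [hk h0, hk h1] at this
  norm_num at this

theorem IsConformalOn.frontier_image_unitBall_nonempty (hF : IsConformalOn F (ball 0 1)) :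
    (frontier (F '' ball 0 1)).Nonempty :=
  nonempty_frontier_iff.2 ⟨(nonempty_ball.2 one_pos).image F, hF.image_unitBall_ne_univ⟩

theorem boundaryDist_pos (hD : IsOpen D) (hfr : (frontier D).Nonempty) {z : ℂ} (hz : z ∈ D) :
    0 < boundaryDist D z :=
  (isClosed_frontier.notMem_iff_infDist_pos hfr).1
    fun h ↦ (hD.inter_frontier_eq ▸ ⟨hz, h⟩ : z ∈ (∅ : Set ℂ))

/-- The distance to the boundary of the image of the centre of the disk is at most the modulus of
the derivative. -/
theorem IsConformalOn.boundaryDist_le_norm_deriv_zero (hF : IsConformalOn F (ball 0 1)) :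
    boundaryDist (F '' ball 0 1) (F 0) ≤ ‖deriv F 0‖ := by
  have h0 : (0 : ℂ) ∈ ball (0 : ℂ) 1 := mem_ball_self one_pos
  set δ := boundaryDist (F '' ball 0 1) (F 0)
  have hδ : 0 < δ := boundaryDist_pos (hF.isOpen_image isOpen_ball)
    hF.frontier_image_unitBall_nonempty (mem_image_of_mem F h0)
  have hsub : ball (F 0) δ ⊆ F '' ball 0 1 := ball_boundaryDist_subset (hF.isOpen_image isOpen_ball)
    (mem_image_of_mem F h0)
  set k := Function.invFunOn F (ball 0 1)
  have hk : LeftInvOn k F (ball 0 1) := hF.injOn.leftInvOn_invFunOn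
  have hkc := hF.of_leftInvOn isOpen_ball hk
  have hkm : MapsTo k (F '' ball 0 1) (ball 0 1) :=
    mapsTo_iff_image_subset.2 hk.image_image.le
  have h1 := norm_deriv_mul_le_of_mapsTo_ball hδ (hkc.differentiableOn.mono hsub)
    (hkm.mono_left hsub)
  have h2 := congrArg norm (hF.deriv_mul_deriv_of_leftInvOn isOpen_ball hk h0)
  rw [hk h0, norm_zero] at h1
  rw [norm_mul, norm_one] at h2
  have h3 : 0 < ‖deriv F 0‖ := norm_pos_iff.2 (hF.deriv_ne_zero isOpen_ball h0)
  nlinarith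

/-- The **Koebe quarter theorem**. -/
theorem IsConformalOn.norm_deriv_zero_le_boundaryDist (hF : IsConformalOn F (ball 0 1)) :
    ‖deriv F 0‖ ≤ 4 * boundaryDist (F '' ball 0 1) (F 0) := by
  rw [← div_le_iff₀' four_pos, boundaryDist, le_infDist hF.frontier_image_unitBall_nonempty]
  intro p hp
  -- The image is open, so F omits its frontier points and F - p is zero-free.
  have hp' : p ∉ F '' ball 0 1 := fun h ↦
    ((hF.isOpen_image isOpen_ball).inter_frontier_eq ▸ ⟨h, hp⟩ : p ∈ (∅ : Set ℂ))
  have h := norm_deriv_zero_le_of_ne_zero (F := fun z ↦ F z - p)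
    ⟨hF.differentiableOn.sub_const p, fun z hz w hw e ↦ hF.injOn hz hw (sub_left_injective e)⟩
    fun z hz e ↦ hp' ⟨z, hz, sub_eq_zero.1 e⟩
  rw [deriv_sub_const] at h
  rwa [div_le_iff₀' four_pos, dist_eq_norm]

theorem IsConformalOn.boundaryDist_bounds (hF : IsConformalOn F (ball 0 1)) {ζ : ℂ}
    (hζ : ζ ∈ ball (0 : ℂ) 1) :
    boundaryDist (F '' ball 0 1) (F ζ) ≤ (1 - ‖ζ‖ ^ 2) * ‖deriv F ζ‖ ∧
      (1 - ‖ζ‖ ^ 2) * ‖deriv F ζ‖ ≤ 4 * boundaryDist (F '' ball 0 1) (F ζ) := by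
  have hFa := hF.comp (isConformalOn_diskAut hζ) (mapsTo_diskAut hζ)
  have himg : (F ∘ diskAut ζ) '' ball 0 1 = F '' ball 0 1 := by
    rw [image_comp, image_diskAut hζ]
  have h0 := hasDerivAt_diskAut_zero ζ
  have hd : DifferentiableAt ℂ F (diskAut ζ 0) := by
    rw [diskAut_zero]; exact hF.differentiableAt isOpen_ball hζ
  have hder : ‖deriv (F ∘ diskAut ζ) 0‖ = (1 - ‖ζ‖ ^ 2) * ‖deriv F ζ‖ := by
    rw [deriv_comp 0 hd h0.differentiableAt, h0.deriv, norm_mul, Complex.norm_real, diskAut_zero,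
      Real.norm_of_nonneg (one_sub_norm_sq_pos hζ).le, mul_comm]
  have h1 := hFa.boundaryDist_le_norm_deriv_zero
  have h2 := hFa.norm_deriv_zero_le_boundaryDist
  rw [himg, hder, Function.comp_apply, diskAut_zero] at h1 h2
  exact ⟨h1, h2⟩

/-- The hyperbolic density bounds for a conformal mapping of a simply connected region. -/
theorem IsConformalOn.hyperbolicDensity_bounds {f : ℂ → ℂ} (hf : IsConformalOn f D)
    (hD : IsOpen D) (hDc : IsSimplyConnected D) (hne : D ≠ univ) {z : ℂ} (hz : z ∈ D) :
    hyperbolicDensity D z ≤ ‖deriv f z‖ / boundaryDist (f '' D) (f z) ∧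
      ‖deriv f z‖ / boundaryDist (f '' D) (f z) ≤ 4 * hyperbolicDensity D z := by
  obtain ⟨g, ζ, hg, rfl, hζ, rfl, hden⟩ := exists_hyperbolicDensity_eq hD hDc hne hz
  have hF : IsConformalOn (f ∘ g) (ball 0 1) := hf.comp hg (mapsTo_image g _)
  have hpos : 0 < boundaryDist ((f ∘ g) '' ball 0 1) ((f ∘ g) ζ) :=
    boundaryDist_pos (hF.isOpen_image isOpen_ball) hF.frontier_image_unitBall_nonempty
      (mem_image_of_mem _ hζ)
  obtain ⟨h1, h2⟩ := hF.boundaryDist_bounds hζ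
  have hder : ‖deriv (f ∘ g) ζ‖ = ‖deriv f (g ζ)‖ * ‖deriv g ζ‖ := by
    rw [deriv_comp ζ (hf.differentiableAt hD hz) (hg.differentiableAt isOpen_ball hζ), norm_mul]
  rw [hder] at h1 h2
  rw [image_comp, Function.comp_apply] at hpos h1 h2
  have hg0 : 0 < ‖deriv g ζ‖ := norm_pos_iff.2 (hg.deriv_ne_zero isOpen_ball hζ)
  have hζ0 := one_sub_norm_sq_pos hζ
  rw [hden, mul_one_div, div_le_div_iff₀ (by positivity) hpos,
    div_le_div_iff₀ hpos (by positivity)]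
  exact ⟨by linarith, by linarith⟩

theorem IsConformalOn.frontier_image_nonempty {f : ℂ → ℂ} (hf : IsConformalOn f D)
    (hD : IsOpen D) (hDc : IsSimplyConnected D) (hne : D ≠ univ) :
    (frontier (f '' D)).Nonempty := by
  obtain ⟨z, hz⟩ := hDc.nonempty
  obtain ⟨g, -, hg, rfl, -⟩ := exists_hyperbolicDensity_eq hD hDc hne hz
  rw [← image_comp]
  exact (hf.comp hg (mapsTo_image g _)).frontier_image_unitBall_nonempty

end BoundaryDistance

/-! ### Sharpness: the Koebe function and the identity. -/

section KoebeFunction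

open Set Metric Filter Topology

theorem one_sub_ne_zero_of_mem_unitBall {z : ℂ} (hz : z ∈ ball (0 : ℂ) 1) : 1 - z ≠ 0 := by
  intro h
  rw [← sub_eq_zero.1 h] at hz
  simp at hz

theorem isConformalOn_koebe : IsConformalOn koebe (ball 0 1) := by
  have hden : ∀ z ∈ ball (0 : ℂ) 1, (1 - z) ^ 2 ≠ 0 := fun z hz ↦
    pow_ne_zero 2 (one_sub_ne_zero_of_mem_unitBall hz)
  refine ⟨DifferentiableOn.div (by fun_prop) (by fun_prop) hden, fun z hz w hw h ↦ ?_⟩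
  have h' := (div_eq_div_iff (hden z hz) (hden w hw)).1 h
  have hprod : (z - w) * (1 - z * w) = 0 := by linear_combination h'
  rcases mul_eq_zero.1 hprod with h0 | h0
  · exact sub_eq_zero.1 h0
  · have : ‖z * w‖ = 1 := by rw [← sub_eq_zero.1 h0, norm_one]
    rw [mem_ball_zero_iff] at hz hw
    rw [norm_mul] at this
    nlinarith [norm_nonneg z, norm_nonneg w]

theorem deriv_koebe {z : ℂ} (hz : z ∈ ball (0 : ℂ) 1) :
    deriv koebe z = (1 + z) / (1 - z) ^ 3 := by
  have h0 := one_sub_ne_zero_of_mem_unitBall hz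
  have h1 : HasDerivAt (fun z : ℂ ↦ (1 - z) ^ 2) (2 * (1 - z) * (-1)) z :=
    (((hasDerivAt_id z).const_sub 1).fun_pow 2).congr_deriv (by simp)
  refine ((hasDerivAt_id z).fun_div h1 (pow_ne_zero 2 h0)).deriv.trans ?_
  simp only [id]
  field_simp
  ring

/-- The value -1/4 is k(-1), a limit of values from the disk. Inside the disk it is omitted, as k(z)
= -1/4 means (1 + z)² = 0. -/
theorem neg_inv_four_mem_frontier_koebe_image :
    (-(1 / 4) : ℂ) ∈ frontier (koebe '' ball 0 1) := by
  rw [(isConformalOn_koebe.isOpen_image isOpen_ball).frontier_eq]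
  refine ⟨?_, ?_⟩
  · have hc : ContinuousAt koebe (-1) :=
      ContinuousAt.div (by fun_prop) (by fun_prop) (by norm_num)
    have hv : koebe (-1) = -(1 / 4) := by norm_num [koebe]
    rw [← hv]
    refine hc.continuousWithinAt.mem_closure_image (s := ball 0 1) ?_
    rw [closure_ball _ one_ne_zero]
    simp
  · rintro ⟨z, hz, h⟩
    rw [koebe, div_eq_iff (pow_ne_zero 2 (one_sub_ne_zero_of_mem_unitBall hz))] at h
    have hsq : (1 + z) ^ 2 = 0 := by linear_combination 4 * h
    rw [eq_neg_of_add_eq_zero_right (pow_eq_zero_iff two_ne_zero |>.1 hsq)] at hz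
    simp at hz

theorem ofReal_mem_unitBall {x : ℝ} (h1 : -1 < x) (h2 : x < 1) : (x : ℂ) ∈ ball (0 : ℂ) 1 := by
  rw [mem_ball_zero_iff, Complex.norm_real, Real.norm_eq_abs, abs_lt]
  exact ⟨h1, h2⟩

/-- One inequality is the general upper bound. For the other an upper bound on the boundary distance
suffices, and the frontier point -1/4 gives it: k(x) + 1/4 = (1 + x)²/(4(1 - x)²). -/
theorem norm_deriv_koebe_div_boundaryDist {x : ℝ} (h1 : -1 < x) (h2 : x < 1) :
    ‖deriv koebe x‖ / boundaryDist (koebe '' ball 0 1) (koebe x) =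
      4 * hyperbolicDensity (ball 0 1) x := by
  have hx := ofReal_mem_unitBall h1 h2
  refine le_antisymm (isConformalOn_koebe.hyperbolicDensity_bounds isOpen_ball
    (isSimplyConnected_ball (0 : ℂ) one_pos) unitBall_ne_univ hx).2 ?_
  have hpos : 0 < boundaryDist (koebe '' ball 0 1) (koebe x) :=
    boundaryDist_pos (isConformalOn_koebe.isOpen_image isOpen_ball)
      ⟨_, neg_inv_four_mem_frontier_koebe_image⟩ (mem_image_of_mem _ hx)
  have hx0 : 0 < 1 - x := by linarith
  have hx1 : 0 < 1 + x := by linarith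
  have hder : ‖deriv koebe x‖ = (1 + x) / (1 - x) ^ 3 := by
    rw [deriv_koebe hx, show (1 + (x : ℂ)) / (1 - x) ^ 3 = ((1 + x) / (1 - x) ^ 3 : ℝ) by push_cast; rfl,
      Complex.norm_real, Real.norm_of_nonneg (by positivity)]
  have hdist : boundaryDist (koebe '' ball 0 1) (koebe x) ≤ (1 + x) ^ 2 / (4 * (1 - x) ^ 2) := by
    refine (infDist_le_dist_of_mem neg_inv_four_mem_frontier_koebe_image).trans_eq ?_
    rw [dist_eq_norm, show koebe x - -(1 / 4) = ((1 + x) ^ 2 / (4 * (1 - x) ^ 2) : ℝ) by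
      have : (1 - (x : ℂ)) ≠ 0 := one_sub_ne_zero_of_mem_unitBall hx
      rw [koebe]; push_cast; field_simp; ring, Complex.norm_real,
      Real.norm_of_nonneg (by positivity)]
  rw [hyperbolicDensity_unitBall hx, hder, Complex.norm_real, Real.norm_eq_abs, sq_abs,
    le_div_iff₀ hpos]
  have hprod : 0 < 1 - x ^ 2 := by nlinarith
  calc 4 * (1 / (1 - x ^ 2)) * boundaryDist (koebe '' ball 0 1) (koebe x)
      ≤ 4 * (1 / (1 - x ^ 2)) * ((1 + x) ^ 2 / (4 * (1 - x) ^ 2)) := by gcongr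
    _ = (1 + x) / (1 - x) ^ 3 := by
      rw [show 1 - x ^ 2 = (1 - x) * (1 + x) by ring]
      field_simp

theorem boundaryDist_unitBall_zero : boundaryDist (ball (0 : ℂ) 1) 0 = 1 := by
  rw [boundaryDist, frontier_ball _ one_ne_zero]
  refine le_antisymm ?_ ((le_infDist (NormedSpace.sphere_nonempty.2 zero_le_one)).2 fun p hp ↦ ?_)
  · exact (infDist_le_dist_of_mem (show (1 : ℂ) ∈ sphere (0 : ℂ) 1 by simp)).trans_eq (by simp)
  · rw [dist_comm, mem_sphere.1 hp]

end KoebeFunction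
theorem theorem2p1 :
    -- the two-sided estimate; the boundary of the image is nonempty, so `δ` is a true distance
    (∀ (D : Set ℂ) (f : ℂ → ℂ), IsOpen D → IsSimplyConnected D → D ≠ Set.univ →
      IsConformalOn f D →
      (frontier (f '' D)).Nonempty ∧
      ∀ z ∈ D,
        hyperbolicDensity D z ≤ ‖deriv f z‖ / boundaryDist (f '' D) (f z) ∧
        ‖deriv f z‖ / boundaryDist (f '' D) (f z) ≤ 4 * hyperbolicDensity D z) ∧
    -- the unit disk is an admissible region
    IsSimplyConnected (Metric.ball (0 : ℂ) 1) ∧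
    -- the upper bound is attained by the Koebe function, at every real point of the disk
    (IsConformalOn koebe (Metric.ball 0 1) ∧
      ∀ x : ℝ, -1 < x → x < 1 →
        ‖deriv koebe x‖ / boundaryDist (koebe '' Metric.ball 0 1) (koebe x) =
          4 * hyperbolicDensity (Metric.ball 0 1) x) ∧
    -- the lower bound is attained by the identity function, at the origin
    (IsConformalOn id (Metric.ball 0 1) ∧
      hyperbolicDensity (Metric.ball 0 1) 0 =
        ‖deriv (id : ℂ → ℂ) 0‖ / boundaryDist (id '' Metric.ball 0 1) (id 0) ∧
      hyperbolicDensity (Metric.ball 0 1) 0 = 1) := by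
  refine ⟨fun D f hD hDc hne hf ↦ ⟨hf.frontier_image_nonempty hD hDc hne,
    fun z hz ↦ hf.hyperbolicDensity_bounds hD hDc hne hz⟩,
    isSimplyConnected_ball (0 : ℂ) one_pos,
    ⟨isConformalOn_koebe, fun x h1 h2 ↦ norm_deriv_koebe_div_boundaryDist h1 h2⟩,
    ⟨differentiableOn_id, Set.injOn_id _⟩, ?_, ?_⟩
  · rw [hyperbolicDensity_unitBall (Metric.mem_ball_self one_pos), Set.image_id, id,
      boundaryDist_unitBall_zero, deriv_id, norm_one, norm_zero]
    norm_num
  · rw [hyperbolicDensity_unitBall (Metric.mem_ball_self one_pos), norm_zero]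
    norm_num
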